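/- Let $k$ be an algebraically closed field and $R=k[x_0,x_1,x_2]$, with graded pieces $R_n$. Let $r>2$ and let $d_1\ge d_2\ge\dots\ge d_r\ge 1$ be integers. Put $$d=d_1+\dots+d_r,\quad D=\sum_{1\le i<j\le r}d_id_j,\quad s=d_2+\dots+d_r,\quad p=\sum_{2\le i<j\le r}d_id_j .$$ For a tuple of forms $(F_1,\dots,F_r)$ with $F_i\in R_{d_i}$ and product $F=F_1\cdots F_r$, let $I_F\subset R$ be the ideal generated by the $r$ products $F/F_i=\prod_{j\ne i}F_j$; define $I_G$ in the same way from a second tuple $(G_1,\dots,G_r)$ with $G_i\in R_{d_i}$. Let $I_Z=I_F\cap I_G$ (the ideal of the union $Z\subset\mathbb P^2$ of the two schemes defined by $I_F$ and $I_G$), and let $(I_Z)_d=I_Z\cap R_d$. The expected dimension of $(I_Z)_d$ is $\max\{\binom{d+2}{2}-2D,\,0\}$; its defect is $\delta=\dim_k(I_Z)_d-\max\{\binom{d+2}{2}-2D,\,0\}$, and $(I_Z)_d$ is called defective if $\delta>0$. Suppose $2p-3s>0$. Then for a general choice of the forms $F_1,\dots,F_r,G_1,\dots,G_r$ (that is,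 for all choices in some nonempty Zariski-open subset of $\prod_i R_{d_i}\times\prod_i R_{d_i}$): (i) if $d_1\ge s-1$, then $\dim_k (I_Z)_d=\binom{d_1-s+2}{2}$; (ii) if $d_1\ge s$, then $(I_Z)_d$ is defective, with defect $\delta=\min\left\{\binom{d_1-s+2}{2},\;2p-3s\right\}$. -/

import Mathlib

namespace ReducibleForms

open MvPolynomial

/-! Numerical invariants of `d = (d₁, …, d_r)`, indexed by `Fin r` (so `d₁` is `d 0`). -/

/-- `d = d₁ + ⋯ + d_r`. -/
def totalDeg {r : ℕ} (d : Fin r → ℕ) : ℕ := ∑ i, d i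

/-- `D`, the sum of `d_i d_j` over `i < j`. -/
def D {r : ℕ} (d : Fin r → ℕ) : ℕ := ∑ i, ∑ j ∈ Finset.Ioi i, d i * d j

/-- `s = d₂ + ⋯ + d_r`. -/
def s {r : ℕ} [NeZero r] (d : Fin r → ℕ) : ℕ := ∑ i ∈ Finset.Ioi (0 : Fin r), d i

/-- `p`, the sum of `d_i d_j` over `2 ≤ i < j ≤ r`. -/
def p {r : ℕ} [NeZero r] (d : Fin r → ℕ) : ℕ :=
  ∑ i ∈ Finset.Ioi (0 : Fin r), ∑ j ∈ Finset.Ioi i, d i * d j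

variable (k : Type*) [Field k]

/-- Tuples `(F₁, …, F_r)` of ternary forms, `F_i` homogeneous of degree `d_i`. -/
abbrev FormTuple {r : ℕ} (d : Fin r → ℕ) : Type _ :=
  (i : Fin r) → homogeneousSubmodule (Fin 3) k (d i)

variable {k}

/-- The coefficients of a tuple of forms, as coordinates on the affine space of tuples. -/
noncomputable def FormTuple.coords {r : ℕ} {d : Fin r → ℕ} (F : FormTuple k d) :
    Fin r × (Fin 3 →₀ ℕ) → k :=
  fun c => coeff c.2 (F c.1 : MvPolynomial (Fin 3) k)

/-- `P F G` holds for a general pair `(F, G)` of tuples of forms: it holds on the nonempty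
basic Zariski-open set where some polynomial `Φ` in the coefficients of `F` and `G`
does not vanish. -/
def ForGeneralPair {r : ℕ} {d : Fin r → ℕ} (P : FormTuple k d → FormTuple k d → Prop) : Prop :=
  ∃ Φ : MvPolynomial ((Fin r × (Fin 3 →₀ ℕ)) ⊕ (Fin r × (Fin 3 →₀ ℕ))) k,
    (∃ F G : FormTuple k d, eval (Sum.elim F.coords G.coords) Φ ≠ 0) ∧
    ∀ F G : FormTuple k d, eval (Sum.elim F.coords G.coords) Φ ≠ 0 → P F G

/-- `I_F`, the ideal generated by `F/F₁, …, F/F_r` where `F = F₁ ⋯ F_r`. -/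
noncomputable def idealY {r : ℕ} {d : Fin r → ℕ} (F : FormTuple k d) : Ideal (MvPolynomial (Fin 3) k) :=
  Ideal.span (Set.range fun i : Fin r =>
    ∏ j ∈ Finset.univ.erase i, (F j : MvPolynomial (Fin 3) k))

/-- `I_Z = I_F ∩ I_G`, the ideal of the scheme-theoretic union `Z = Y_F ∪ Y_G`. -/
noncomputable def idealZ {r : ℕ} {d : Fin r → ℕ} (F G : FormTuple k d) : Ideal (MvPolynomial (Fin 3) k) :=
  idealY F ⊓ idealY G

/-- The degree `n` part `I_n` of an ideal `I` of `k[x₀, x₁, x₂]`. -/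
noncomputable def degreePart (I : Ideal (MvPolynomial (Fin 3) k)) (n : ℕ) :
    Submodule k (MvPolynomial (Fin 3) k) :=
  I.restrictScalars k ⊓ homogeneousSubmodule (Fin 3) k n

/-- `dim_k (I_Z)_d`. -/
noncomputable def dimIZ {r : ℕ} {d : Fin r → ℕ} (F G : FormTuple k d) : ℕ :=
  Module.finrank k (degreePart (idealZ F G) (totalDeg d))

/-- `exp.dim (I_Z)_d = max {C(d + 2, 2) - 2D, 0}`. -/
def expDimIZ {r : ℕ} (d : Fin r → ℕ) : ℤ :=
  max (((totalDeg d + 2).choose 2 : ℤ) - 2 * (D d : ℤ)) 0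

/-- The defect `δ = dim (I_Z)_d - exp.dim (I_Z)_d`. -/
noncomputable def defect {r : ℕ} {d : Fin r → ℕ} (F G : FormTuple k d) : ℤ :=
  (dimIZ F G : ℤ) - expDimIZ d

/-- `(I_Z)_d` is defective if its defect is positive. -/
def IsDefective {r : ℕ} {d : Fin r → ℕ} (F G : FormTuple k d) : Prop :=
  0 < defect F G

end ReducibleForms

/-! Indices are those of the statement here; in the code the index 1 becomes `0`. Write T_F for
`tangentMap F`, (H_i) ↦ ∑ H_i F/F_i. Its image is (I_F)_d, so (I_Z)_d is the intersection of the
images of T_F and T_G. If d_1 ≥ s, this intersection contains all multiples of F_2⋯F_r G_2⋯G_r by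
forms of degree d_1 - s, which gives the lower bound (`choose_le_dimIZ`).

For the upper bound, consider the kernel of (H, K) ↦ T_F H - T_G K (`differenceMap`). Its dimension
is at least dim (I_Z)_d + 2(r - 1), since for nonzero forms each of T_F, T_G kills the (r -
1)-dimensional space of tuples (c_i F_i) with ∑ c_i = 0 (`dimIZ_add_le_finrank_ker`). Kernel
dimension is upper semicontinuous (`exists_isCoordPoly_finrank_ker_le`), so a single pair with
kernel of dimension at most 2(r - 1) + C(d_1 - s + 2, 2) suffices
(`exists_finrank_ker_differenceMap_le`).

In that pair, F_2, …, F_r are products of s lines of one pencil and G_2, …, G_r products of s lines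
of another; these meet in an s × s grid. On a line of F_i only the term H_i F/F_i survives, and
there it is F_1 H_i times a nonzero constant. Hence T_F H = T_G K yields one equation F_1 H_i u =
G_1 K_j v at each grid point. Rows and columns are then eliminated alternately: once H_i has more
zeros on its row than its remaining degree, the row divides it, and likewise for columns
(`lines_dvd_of_isBalanced`). A pattern `U` decides whether a cell serves its row or its column; F_1
and G_1 are chosen to vanish exactly at the cells needed before the other side is known to vanish
(`exists_vanishing_exactly`). The demands add up to ∑_{i≥2} (d_i² + 3d_i) and the supply is s² =
∑_{i≥2} d_i² + 2p, which is where 2p against 3s enters (`exists_isBalanced`). In the end H_i and K_i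
are scalar multiples of F_i and G_i for i ≥ 2, and what remains is A F_2⋯F_r = B G_2⋯G_r with
coprime products.

The defect then follows from C(d + 2, 2) - 2D = C(d_1 - s + 2, 2) - (2p - 3s). -/

namespace ReducibleForms

open MvPolynomial

/-! ### Divisibility of forms by lines of a pencil -/

section Lines

variable {k : Type*} [Field k]

lemma homogeneousComponent_mul_of_isHomogeneous {σ : Type*} {P : MvPolynomial σ k} {m : ℕ}
    (hP : P.IsHomogeneous m) (Q : MvPolynomial σ k) (n : ℕ) :
    homogeneousComponent (m + n) (P * Q) = P * homogeneousComponent n Q := by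
  classical
  conv_lhs => rw [← sum_homogeneousComponent Q, Finset.mul_sum, map_sum]
  have h : ∀ i, homogeneousComponent (m + n) (P * homogeneousComponent i Q)
      = if i = n then P * homogeneousComponent n Q else 0 := by
    intro i
    rw [homogeneousComponent_of_mem (hP.mul (homogeneousComponent_isHomogeneous i Q))]
    by_cases hi : i = n
    · subst hi; simp
    · rw [if_neg, if_neg hi]; omega
  rw [Finset.sum_congr rfl fun i _ => h i]
  by_cases hn : n ≤ Q.totalDegree
  · rw [Finset.sum_ite_eq' , if_pos (by simpa using Nat.lt_succ_of_le hn)]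
  · rw [homogeneousComponent_eq_zero _ _ (not_le.mp hn)]; simp

lemma eval_smul_of_isHomogeneous {σ : Type*} {P : MvPolynomial σ k} {n : ℕ}
    (hP : P.IsHomogeneous n) (c : k) (v : σ → k) :
    eval (c • v) P = c ^ n * eval v P := by
  rw [eval_eq, eval_eq, Finset.mul_sum]
  refine Finset.sum_congr rfl fun e he => ?_
  have hdeg : ∑ i ∈ e.support, e i = n := by
    simpa [Finsupp.degree_apply] using hP.degree_eq_sum_deg_support he |>.symm
  simp only [Pi.smul_apply, smul_eq_mul, mul_pow, Finset.prod_mul_distrib]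
  rw [Finset.prod_pow_eq_pow_sum, hdeg]
  ring

/-- The form `X_i - a X₂`. -/
noncomputable def line (i : Fin 3) (a : k) : MvPolynomial (Fin 3) k := X i - C a * X 2

/-- The point with last coordinate `1`, coordinate `i` equal to `a` and remaining coordinate `b`. -/
def pt (i : Fin 3) (a b : k) : Fin 3 → k := fun l => if l = 2 then 1 else if l = i then a else b

lemma line_isHomogeneous (i : Fin 3) (a : k) : (line i a).IsHomogeneous 1 :=
  (isHomogeneous_X k i).sub (isHomogeneous_C_mul_X a 2)

lemma line_ne_zero {i : Fin 3} (hi : i ≠ 2) (a : k) : line i a ≠ 0 := by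
  intro h
  have := congrArg (eval (Pi.single i 1)) h
  simp [line, hi.symm] at this

lemma eval_line_pt {i : Fin 3} (hi : i ≠ 2) (c a b : k) : eval (pt i a b) (line i c) = a - c := by
  simp [line, pt, hi]

lemma pt_swap (a b : k) : pt 1 b a = pt 0 a b := by
  funext l; fin_cases l <;> simp [pt]

/-- On the line, `P` becomes a univariate polynomial of degree at most `n` with more than `n` roots,
hence zero. Modulo the line, `P` is congruent to its restriction under `X i ↦ a X 2`, which
therefore vanishes. -/
lemma line_dvd_of_eval_eq_zero [Infinite k] {i : Fin 3} (hi : i ≠ 2) {a : k}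
    {P : MvPolynomial (Fin 3) k} {n : ℕ} (hP : P.IsHomogeneous n)
    {S : Finset k} (hS : n < S.card) (h : ∀ t ∈ S, eval (pt i a t) P = 0) : line i a ∣ P := by
  have hall : ∀ t, eval (pt i a t) P = 0 := by
    let f : Fin 3 → Polynomial k :=
      fun l => if l = 2 then 1 else if l = i then Polynomial.C a else Polynomial.X
    have hf : ∀ t, (aeval f P).eval t = eval (pt i a t) P := by
      intro t
      have : (Polynomial.evalRingHom t).comp (aeval f : MvPolynomial (Fin 3) k →ₐ[k] _).toRingHom
          = eval (pt i a t) := by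
        apply MvPolynomial.ringHom_ext
        · intro r; simp
        · intro l; by_cases h2 : l = 2 <;> by_cases h3 : l = i <;> simp_all [f, pt]
      exact congrArg (fun g => g P) this
    have hdeg : (aeval f P).natDegree ≤ n := by
      have := MvPolynomial.aeval_natDegree_le (m := n) (n := 1) P hP.totalDegree_le f (fun l => by
        simp only [f]; split_ifs <;> simp)
      simpa using this
    have hz : aeval f P = 0 := by
      refine Polynomial.eq_zero_of_natDegree_lt_card_of_eval_eq_zero' _ S (fun t ht => ?_)
        (lt_of_le_of_lt hdeg hS)
      rw [hf, h t ht]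
    intro t; rw [← hf, hz, Polynomial.eval_zero]
  let g : Fin 3 → MvPolynomial (Fin 3) k := fun l => if l = i then C a * X 2 else X l
  have hsub : ∀ Q : MvPolynomial (Fin 3) k, line i a ∣ Q - aeval g Q := by
    intro Q
    induction Q using MvPolynomial.induction_on with
    | C c => simp
    | add p q hp hq => rw [map_add, add_sub_add_comm]; exact dvd_add hp hq
    | mul_X p l hp =>
      have : p * X l - aeval g (p * X l) = (p - aeval g p) * X l + aeval g p * (X l - g l) := by
        rw [map_mul, aeval_X]; ring
      rw [this]
      refine dvd_add (hp.mul_right _) (Dvd.dvd.mul_left ?_ _)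
      simp only [g]; split_ifs with hl
      · subst hl; exact dvd_rfl
      · simp
  have hzero : aeval g P = 0 := by
    -- The points `pt` and their multiples only reach vectors with `v 2 ≠ 0`; the factor `X 2`
    -- disposes of the others.
    have : X 2 * aeval g P = 0 := by
      apply MvPolynomial.funext
      intro v
      rw [map_mul, eval_X, map_zero]
      by_cases hv : v 2 = 0
      · simp [hv]
      · have he : eval v (aeval g P) = eval (fun l => if l = i then a * v 2 else v l) P := by
          have : (eval v).comp (aeval g : MvPolynomial (Fin 3) k →ₐ[k] _).toRingHom
              = eval (fun l => if l = i then a * v 2 else v l) := by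
            apply MvPolynomial.ringHom_ext
            · intro r; simp
            · intro l; by_cases h3 : l = i <;> simp [g, h3]
          exact congrArg (fun g => g P) this
        obtain ⟨j, hj⟩ : ∃ j : Fin 3, ∀ l, l ≠ 2 → l ≠ i → l = j := by
          fin_cases i
          · exact ⟨1, by decide⟩
          · exact ⟨0, by decide⟩
          · exact absurd rfl hi
        have hpt : (fun l => if l = i then a * v 2 else v l) = v 2 • pt i a (v j / v 2) := by
          funext l
          by_cases h2 : l = 2
          · subst h2; simp [pt, hi.symm]
          · by_cases h3 : l = i
            · subst h3; simp [pt, h2, mul_comm]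
            · have := hj l h2 h3
              subst this
              simp [pt, h2, h3]; field_simp
        rw [he, hpt, eval_smul_of_isHomogeneous hP, hall]; simp
    exact (mul_eq_zero.mp this).resolve_left (X_ne_zero 2)
  have := hsub P
  rwa [hzero, sub_zero] at this

lemma exists_isHomogeneous_mul_of_dvd {P Q : MvPolynomial (Fin 3) k} {m n : ℕ}
    (hP : P.IsHomogeneous m) (hQ : Q.IsHomogeneous (m + n)) (h : P ∣ Q) :
    ∃ T : MvPolynomial (Fin 3) k, T.IsHomogeneous n ∧ Q = P * T := by
  obtain ⟨T, rfl⟩ := h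
  refine ⟨homogeneousComponent n T, homogeneousComponent_isHomogeneous n T, ?_⟩
  rw [← homogeneousComponent_mul_of_isHomogeneous hP, homogeneousComponent_eq_self hQ]

lemma eval_eq_zero_of_line_dvd {i : Fin 3} (hi : i ≠ 2) {a : k} {P : MvPolynomial (Fin 3) k}
    (h : line i a ∣ P) (t : k) : eval (pt i a t) P = 0 := by
  obtain ⟨Q, rfl⟩ := h
  rw [map_mul, eval_line_pt hi, sub_self, zero_mul]

/-- A form divisible by distinct lines of the pencil is divisible by their product. -/
lemma prod_line_dvd [Infinite k] {i : Fin 3} (hi : i ≠ 2) {α : Type*} (S : Finset α) (x : α → k)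
    (hx : Set.InjOn x S) {P : MvPolynomial (Fin 3) k} {n : ℕ} (hP : P.IsHomogeneous (S.card + n))
    (h : ∀ a ∈ S, line i (x a) ∣ P) :
    ∃ T : MvPolynomial (Fin 3) k, T.IsHomogeneous n ∧ P = (∏ a ∈ S, line i (x a)) * T := by
  classical
  induction S using Finset.induction_on generalizing n with
  | empty => exact ⟨P, by simpa using hP, by simp⟩
  | insert b S hb ih =>
    rw [Finset.card_insert_of_notMem hb] at hP
    obtain ⟨T, hT, hPT⟩ := ih (hx.mono (by simp)) (n := n + 1)
      (by convert hP using 1; ring) (fun a ha => h a (Finset.mem_insert_of_mem ha))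
    have hdvd : line i (x b) ∣ T := by
      obtain ⟨A, hA⟩ := Infinite.exists_subset_card_eq k (n + 2)
      refine line_dvd_of_eval_eq_zero hi hT (S := A) (by omega) fun t _ => ?_
      have h0 := eval_eq_zero_of_line_dvd hi (h b (Finset.mem_insert_self b S)) t
      rw [hPT, map_mul, map_prod] at h0
      refine (mul_eq_zero.mp h0).resolve_left (Finset.prod_ne_zero_iff.mpr fun a ha => ?_)
      rw [eval_line_pt hi, sub_ne_zero]
      intro hab
      have := hx (Finset.mem_insert_self b S) (Finset.mem_insert_of_mem ha) hab
      exact hb (this ▸ ha)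
    obtain ⟨U, hU, hTU⟩ := exists_isHomogeneous_mul_of_dvd (line_isHomogeneous i (x b))
      (by rwa [add_comm] at hT) hdvd
    exact ⟨U, hU, by rw [hPT, hTU, Finset.prod_insert hb]; ring⟩

lemma prod_line_isHomogeneous (i : Fin 3) {α : Type*} (S : Finset α) (x : α → k) :
    (∏ a ∈ S, line i (x a)).IsHomogeneous S.card := by
  simpa using IsHomogeneous.prod S (fun a => line i (x a)) (fun _ => 1)
    (fun a _ => line_isHomogeneous i (x a))

lemma prod_line_ne_zero {i : Fin 3} (hi : i ≠ 2) {α : Type*} (S : Finset α) (x : α → k) :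
    ∏ a ∈ S, line i (x a) ≠ 0 :=
  Finset.prod_ne_zero_iff.mpr fun a _ => line_ne_zero hi (x a)

/-- A form of degree `n` divisible by more than `n` distinct lines of the pencil is zero. -/
lemma eq_zero_of_line_dvd [Infinite k] {i : Fin 3} (hi : i ≠ 2) {α : Type*} (S : Finset α)
    (x : α → k) (hx : Set.InjOn x S) {P : MvPolynomial (Fin 3) k} {n : ℕ} (hP : P.IsHomogeneous n)
    (hn : n < S.card) (h : ∀ a ∈ S, line i (x a) ∣ P) : P = 0 := by
  obtain ⟨S', hS', hcard⟩ := Finset.exists_subset_card_eq (show n + 1 ≤ S.card from hn)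
  -- The factor `X 2` raises the degree to `n + 1`, so the cofactor of the `n + 1` lines is a
  -- constant. Evaluation at the basis vector `e_i`, where `X 2` vanishes and every line is 1, shows
  -- that this constant is zero.
  obtain ⟨T, hT, hPT⟩ := prod_line_dvd hi S' x (hx.mono hS') (n := 0) (P := P * X 2)
    (by simpa [hcard] using hP.mul (isHomogeneous_X k 2))
    (fun a ha => (h a (hS' ha)).mul_right _)
  obtain ⟨c, rfl⟩ : ∃ c, T = C c := ⟨_, totalDegree_eq_zero_iff_eq_C.mp (by
    have := hT.totalDegree_le; omega)⟩
  have h0 := congrArg (eval (Pi.single i 1 : Fin 3 → k)) hPT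
  have hc : c = 0 := by
    have : ∀ a, eval (Pi.single i 1 : Fin 3 → k) (line i a) = 1 := by
      intro a; simp [line, hi.symm]
    simpa [map_prod, this, hi.symm] using h0.symm
  rw [hc, map_zero, mul_zero] at hPT
  exact (mul_eq_zero.mp hPT).resolve_right (X_ne_zero 2)

end Lines

/-! ### Elimination of the lines of a grid -/

section Elimination

/-- One more than the number of positions `l ≥ i` carrying the same label as `i`. -/
def demand {n : ℕ} {ι : Type*} [DecidableEq ι] (β : Fin n → ι) (i : Fin n) : ℕ :=
  (Finset.univ.filter fun l => i ≤ l ∧ β l = β i).card + 1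

/-- `U` is an off-diagonal pattern in the `n × n` grid such that row `i` contains at least
`demand β i` cells of `U` and column `j` contains at least `demand β j` cells outside `U`. -/
structure IsBalanced {n : ℕ} {ι : Type*} [DecidableEq ι] (β : Fin n → ι)
    (U : Fin n → Fin n → Bool) : Prop where
  diag : ∀ i, U i i = false
  row : ∀ i, demand β i ≤ (Finset.univ.filter fun j => U i j = true).card
  col : ∀ j, demand β j ≤ (Finset.univ.filter fun i => U i j = false).card

variable {k : Type*} [Field k]

lemma pt_comm {i₁ i₂ : Fin 3} (h₁ : i₁ ≠ 2) (h₂ : i₂ ≠ 2) (h : i₁ ≠ i₂) (a b : k) :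
    pt i₁ a b = pt i₂ b a := by
  funext l
  by_cases hl : l = 2
  · simp [pt, hl]
  · have : l = i₁ ∨ l = i₂ := by omega
    rcases this with rfl | rfl
    · simp [pt, hl, h]
    · simp [pt, hl, h.symm]

/-- Once the earlier lines with the same label are split off, the quotient has degree equal to the
number of `l ≥ m` with that label, and `demand` is one more. The lines split off have no zero on
line `m`, so the zeros pass to the quotient. -/
lemma line_dvd_of_demand [Infinite k] {n : ℕ} {ι : Type*} [DecidableEq ι] (β : Fin n → ι)
    {i : Fin 3} (hi : i ≠ 2) {x : Fin n → k} (hx : Function.Injective x) (m : Fin n)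
    {P : MvPolynomial (Fin 3) k}
    (hP : P.IsHomogeneous (Finset.univ.filter fun l => β l = β m).card)
    (hlt : ∀ l < m, β l = β m → line i (x l) ∣ P)
    {S : Finset k} (hS : demand β m ≤ S.card) (h : ∀ t ∈ S, eval (pt i (x m) t) P = 0) :
    line i (x m) ∣ P := by
  set S₀ := Finset.univ.filter fun l => l < m ∧ β l = β m
  set S₁ := Finset.univ.filter fun l => m ≤ l ∧ β l = β m with hS₁
  have hcard : (Finset.univ.filter fun l => β l = β m).card = S₀.card + S₁.card := by
    rw [← Finset.card_union_of_disjoint]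
    · congr 1; ext l
      simp only [S₀, S₁, Finset.mem_filter, Finset.mem_univ, true_and, Finset.mem_union]
      have := lt_or_ge l m
      tauto
    · rw [Finset.disjoint_left]
      intro l hl hl'
      simp only [S₀, S₁, Finset.mem_filter, Finset.mem_univ, true_and] at hl hl'
      exact absurd hl.1 (not_lt.mpr hl'.1)
  obtain ⟨T, hT, rfl⟩ := prod_line_dvd hi S₀ x hx.injOn (hcard ▸ hP) (fun a ha => by
    simp only [S₀, Finset.mem_filter, Finset.mem_univ, true_and] at ha
    exact hlt a ha.1 ha.2)
  refine Dvd.dvd.mul_left (line_dvd_of_eval_eq_zero hi hT (S := S) ?_ fun t ht => ?_) _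
  · simp only [demand] at hS; rw [← hS₁] at hS; omega
  · have h0 := h t ht
    rw [map_mul, map_prod] at h0
    refine (mul_eq_zero.mp h0).resolve_left (Finset.prod_ne_zero_iff.mpr fun a ha => ?_)
    rw [eval_line_pt hi, sub_ne_zero]
    intro hab
    simp only [S₀, Finset.mem_filter, Finset.mem_univ, true_and] at ha
    exact ha.1.ne (hx hab).symm

/-- Successive elimination of the rows and columns of the grid. -/
lemma lines_dvd_of_isBalanced [Infinite k] {n : ℕ} {ι : Type*} [DecidableEq ι] {β : Fin n → ι}
    {U : Fin n → Fin n → Bool} (hU : IsBalanced β U) {x y : Fin n → k}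
    (hx : Function.Injective x) (hy : Function.Injective y)
    {f g u v : Fin n → Fin n → k}
    (hf₀ : ∀ i j, j < i → U i j = false → f i j = 0) (hf : ∀ i j, U i j = true → f i j ≠ 0)
    (hg₀ : ∀ i j, i < j → U i j = true → g i j = 0) (hg : ∀ i j, U i j = false → g i j ≠ 0)
    (hu : ∀ i j, u i j ≠ 0) (hv : ∀ i j, v i j ≠ 0)
    {H K : ι → MvPolynomial (Fin 3) k}
    (hH : ∀ i, (H (β i)).IsHomogeneous (Finset.univ.filter fun l => β l = β i).card)
    (hK : ∀ i, (K (β i)).IsHomogeneous (Finset.univ.filter fun l => β l = β i).card)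
    (heq : ∀ i j, f i j * (eval (pt 0 (x i) (y j)) (H (β i)) * u i j)
      = g i j * (eval (pt 0 (x i) (y j)) (K (β j)) * v i j)) (m : Fin n) :
    line 0 (x m) ∣ H (β m) ∧ line 1 (y m) ∣ K (β m) := by
  classical
  have h0 : (0 : Fin 3) ≠ 2 := by decide
  have h1 : (1 : Fin 3) ≠ 2 := by decide
  induction m using WellFoundedLT.induction with
  | ind m ih =>
  have hrow : line 0 (x m) ∣ H (β m) := by
    refine line_dvd_of_demand β h0 hx m (hH m) (fun l hl hlm => hlm ▸ (ih l hl).1)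
      (S := (Finset.univ.filter fun j => U m j = true).image y) ?_ ?_
    · rw [Finset.card_image_of_injective _ hy]; exact hU.row m
    · intro t ht
      obtain ⟨j, hj, rfl⟩ := Finset.mem_image.mp ht
      simp only [Finset.mem_filter, Finset.mem_univ, true_and] at hj
      -- To the right of the diagonal `g` vanishes by choice; to the left, column `j` is already
      -- eliminated. The diagonal cell is not available, since row `m` comes before column `m`.
      have hzero : g m j * (eval (pt 0 (x m) (y j)) (K (β j)) * v m j) = 0 := by
        rcases lt_trichotomy m j with h | h | h
        · rw [hg₀ m j h hj, zero_mul]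
        · subst h; rw [hU.diag] at hj; exact absurd hj (by simp)
        · rw [← pt_swap, eval_eq_zero_of_line_dvd h1 (ih j h).2]; ring
      rw [← heq] at hzero
      exact (mul_eq_zero.mp ((mul_eq_zero.mp hzero).resolve_left (hf m j hj))).resolve_right
        (hu m j)
  refine ⟨hrow, ?_⟩
  refine line_dvd_of_demand β h1 hy m (hK m) (fun l hl hlm => hlm ▸ (ih l hl).2)
    (S := (Finset.univ.filter fun i => U i m = false).image x) ?_ ?_
  · rw [Finset.card_image_of_injective _ hx]; exact hU.col m
  · intro t ht
    obtain ⟨i, hi, rfl⟩ := Finset.mem_image.mp ht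
    simp only [Finset.mem_filter, Finset.mem_univ, true_and] at hi
    -- Row `m` has just been eliminated, so here the diagonal cell does count.
    have hzero : f i m * (eval (pt 0 (x i) (y m)) (H (β i)) * u i m) = 0 := by
      rcases lt_trichotomy i m with h | h | h
      · rw [eval_eq_zero_of_line_dvd h0 (ih i h).1]; ring
      · subst h; rw [eval_eq_zero_of_line_dvd h0 hrow]; ring
      · rw [hf₀ i m h hi, zero_mul]
    rw [heq] at hzero
    rw [pt_swap]
    exact (mul_eq_zero.mp ((mul_eq_zero.mp hzero).resolve_left (hg i m hi))).resolve_right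
      (hv i m)

end Elimination

/-! ### Forms with prescribed zeros on the grid -/

section Interpolation

variable {k : Type*} [Field k]

lemma eval_line_pt_other {i₁ i₂ : Fin 3} (h₁ : i₁ ≠ 2) (h₂ : i₂ ≠ 2) (h : i₁ ≠ i₂) (c a b : k) :
    eval (pt i₁ a b) (line i₂ c) = b - c := by
  rw [pt_comm h₁ h₂ h, eval_line_pt h₂]

/-- Forms of degree `m` interpolate arbitrary values on a triangular part of the grid. -/
lemma exists_interpolation {i₁ i₂ : Fin 3} (h₁ : i₁ ≠ 2) (h₂ : i₂ ≠ 2) (h₁₂ : i₁ ≠ i₂) {n : ℕ}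
    {x y : Fin n → k} (hx : Function.Injective x) (hy : Function.Injective y) (m a : ℕ)
    (hn : n = a + m + 1) (v : Fin n → Fin n → k) :
    ∃ Q : MvPolynomial (Fin 3) k, Q.IsHomogeneous m ∧
      ∀ i j : Fin n, a ≤ i → i ≤ j → eval (pt i₁ (x i) (y j)) Q = v i j := by
  induction m generalizing a v with
  | zero =>
    refine ⟨C (v ⟨a, by omega⟩ ⟨a, by omega⟩), isHomogeneous_C _ _, fun i j hi hj => ?_⟩
    rw [eval_C]
    have hj' : (i : ℕ) ≤ j := hj
    congr 1 <;> apply Fin.ext <;> simp only <;> omega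
  | succ m ih =>
    let b : Fin n := ⟨a, by omega⟩
    let A := Finset.Ici b
    have hA : A.card = m + 2 := by simp [A, b]; omega
    -- Lagrange interpolation of row `b` in the column coordinate alone. The later rows are
    -- corrected by a multiple of the line of row `b`, which leaves a triangle smaller by one.
    let L : MvPolynomial (Fin 3) k := ∑ j ∈ A,
      C (v b j / ∏ l ∈ A.erase j, (y j - y l)) * ∏ l ∈ A.erase j, line i₂ (y l)
    have hL : L.IsHomogeneous (m + 1) := by
      refine IsHomogeneous.sum _ _ _ fun j hj => ?_
      have := (isHomogeneous_C (Fin 3) (v b j / ∏ l ∈ A.erase j, (y j - y l))).mul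
        (prod_line_isHomogeneous i₂ (A.erase j) y)
      rwa [zero_add, Finset.card_erase_of_mem hj, hA] at this
    have hLe : ∀ c, ∀ j ∈ A, eval (pt i₁ c (y j)) L = v b j := by
      intro c j hj
      simp only [L, map_sum, map_mul, eval_C, map_prod, eval_line_pt_other h₁ h₂ h₁₂]
      rw [Finset.sum_eq_single_of_mem j hj]
      · refine div_mul_cancel₀ _ (Finset.prod_ne_zero_iff.mpr fun l hl => ?_)
        rw [sub_ne_zero]
        exact fun h => (Finset.ne_of_mem_erase hl) (hy h).symm
      · intro l _ hlj
        have : ∏ c ∈ A.erase l, (y j - y c) = 0 :=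
          Finset.prod_eq_zero (Finset.mem_erase.mpr ⟨hlj.symm, hj⟩) (sub_self _)
        rw [this, mul_zero]
    obtain ⟨R, hR, hRe⟩ := ih (a + 1) (by omega)
      (fun i j => (v i j - eval (pt i₁ (x i) (y j)) L) / (x i - x b))
    refine ⟨L + line i₁ (x b) * R, hL.add ?_, fun i j hi hij => ?_⟩
    · rw [add_comm m]; exact (line_isHomogeneous i₁ (x b)).mul hR
    · rw [map_add, map_mul, eval_line_pt h₁]
      by_cases hib : i = b
      · subst hib
        rw [sub_self, zero_mul, add_zero, hLe]
        simpa [A] using hij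
      · have hlt : a + 1 ≤ (i : ℕ) := by
          have : (i : ℕ) ≠ a := fun h => hib (Fin.ext h)
          omega
        rw [hRe i j hlt hij, mul_div_cancel₀]
        · ring
        · rw [sub_ne_zero]; exact fun h => hib (hx h)

/-- There is a form vanishing at exactly those points of the grid
which lie in a prescribed part `Z` of the strict upper triangle. -/
lemma exists_vanishing_exactly [Infinite k] {i₁ i₂ : Fin 3} (h₁ : i₁ ≠ 2) (h₂ : i₂ ≠ 2)
    (h₁₂ : i₁ ≠ i₂) {n : ℕ} {x y : Fin n → k} (hx : Function.Injective x)
    (hy : Function.Injective y) (N : ℕ) (hN : n ≤ N + 1)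
    (Z : Fin n → Fin n → Prop) (hZ : ∀ i j, Z i j → i < j) :
    ∃ Q : MvPolynomial (Fin 3) k, Q.IsHomogeneous N ∧
      ∀ i j, eval (pt i₁ (x i) (y j)) Q = 0 ↔ Z i j := by
  classical
  let ev : Fin n → Fin n → Module.Dual k (MvPolynomial (Fin 3) k) := fun i j =>
    (aeval (pt i₁ (x i) (y j)) : MvPolynomial (Fin 3) k →ₐ[k] k).toLinearMap
  have hev : ∀ i j Q, ev i j Q = eval (pt i₁ (x i) (y j)) Q := fun i j Q => by
    simp [ev, aeval_eq_eval]
  let p : Submodule k (MvPolynomial (Fin 3) k) := homogeneousSubmodule (Fin 3) k N ⊓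
    ⨅ t : {t : Fin n × Fin n // Z t.1 t.2}, LinearMap.ker (ev t.1.1 t.1.2)
  have hp : ∀ Q, Q ∈ p ↔ Q.IsHomogeneous N ∧
      ∀ i j, Z i j → eval (pt i₁ (x i) (y j)) Q = 0 := by
    intro Q
    simp [p, hev]
  -- Over an infinite field, an element of `p` can avoid finitely many proper subspaces at once, so
  -- each point outside `Z` may be treated separately.
  have key : ∀ t : {t : Fin n × Fin n // ¬ Z t.1 t.2}, ∃ Q ∈ p, ev t.1.1 t.1.2 Q ≠ 0 := by
    rintro ⟨⟨i, j⟩, hij⟩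
    have hpos : 0 < n := i.pos
    suffices h : ∃ Q : MvPolynomial (Fin 3) k, Q.IsHomogeneous (n - 1) ∧
        (∀ i j, Z i j → eval (pt i₁ (x i) (y j)) Q = 0) ∧ eval (pt i₁ (x i) (y j)) Q ≠ 0 by
      obtain ⟨Q, hQ, hQ0, hQ1⟩ := h
      have h2 : ∀ a b : k, eval (pt i₁ a b) (X 2 ^ (N - (n - 1))) = 1 := by
        intro a b; simp [pt]
      refine ⟨Q * X 2 ^ (N - (n - 1)), (hp _).mpr ⟨?_, fun i j h => ?_⟩, ?_⟩
      · have := hQ.mul (isHomogeneous_X_pow (R := k) (2 : Fin 3) (N - (n - 1)))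
        rwa [show n - 1 + (N - (n - 1)) = N by omega] at this
      · rw [map_mul, hQ0 i j h, zero_mul]
      · rwa [hev, map_mul, h2, mul_one]
    by_cases hle : i ≤ j
    · obtain ⟨Q, hQ, hQe⟩ := exists_interpolation h₁ h₂ h₁₂ hx hy (n - 1) 0 (by omega)
        (fun i' j' => if i' = i ∧ j' = j then 1 else 0)
      refine ⟨Q, hQ, fun i' j' h => ?_, ?_⟩
      · rw [hQe i' j' (Nat.zero_le _) (hZ _ _ h).le, if_neg]
        rintro ⟨rfl, rfl⟩; exact hij h
      · rw [hQe i j (Nat.zero_le _) hle]; simp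
    -- Below the diagonal: the rows before `i` and the columns after `i` are `n - 1` lines covering
    -- the strict upper triangle, and none of them passes through the cell.
    · refine ⟨(∏ a ∈ Finset.Iio i, line i₁ (x a)) * ∏ b ∈ Finset.Ioi i, line i₂ (y b), ?_, ?_, ?_⟩
      · have := (prod_line_isHomogeneous i₁ (Finset.Iio i) x).mul
          (prod_line_isHomogeneous i₂ (Finset.Ioi i) y)
        rw [Fin.card_Iio, Fin.card_Ioi] at this
        convert this using 1; omega
      · intro i' j' h
        rw [map_mul, map_prod, map_prod]
        by_cases hi' : i' < i
        · rw [Finset.prod_eq_zero (Finset.mem_Iio.mpr hi'), zero_mul]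
          rw [eval_line_pt h₁, sub_self]
        · rw [Finset.prod_eq_zero (i := j') (Finset.mem_Ioi.mpr
            (lt_of_le_of_lt (not_lt.mp hi') (hZ _ _ h))), mul_zero]
          rw [eval_line_pt_other h₁ h₂ h₁₂, sub_self]
      · rw [map_mul, map_prod, map_prod]
        refine mul_ne_zero (Finset.prod_ne_zero_iff.mpr fun a ha => ?_)
          (Finset.prod_ne_zero_iff.mpr fun b hb => ?_)
        · rw [eval_line_pt h₁, sub_ne_zero]
          exact fun h => (Finset.mem_Iio.mp ha).ne (hx h).symm
        · rw [eval_line_pt_other h₁ h₂ h₁₂, sub_ne_zero]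
          exact fun h => ((not_le.mp hle).trans (Finset.mem_Ioi.mp hb)).ne (hy h)
  obtain ⟨Q, hQp, hQ⟩ := Module.Dual.exists_forall_mem_ne_zero_of_forall_exists p
    (fun t : {t : Fin n × Fin n // ¬ Z t.1 t.2} => ev t.1.1 t.1.2) key
  obtain ⟨hQN, hQ0⟩ := (hp Q).mp hQp
  refine ⟨Q, hQN, fun i j => ⟨fun h => ?_, hQ0 i j⟩⟩
  by_contra hn
  exact hQ ⟨(i, j), hn⟩ (by rw [hev]; exact h)

end Interpolation

/-! ### Existence of balanced patterns -/

section Balanced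

/-- Refining the labels can only lower the demands. -/
lemma IsBalanced.of_imp {n : ℕ} {ι κ : Type*} [DecidableEq ι] [DecidableEq κ] {β : Fin n → ι}
    {β' : Fin n → κ} {U : Fin n → Fin n → Bool} (hU : IsBalanced β U)
    (h : ∀ i j, β' i = β' j → β i = β j) : IsBalanced β' U := by
  have hle : ∀ i, demand β' i ≤ demand β i := fun i => by
    refine Nat.succ_le_succ (Finset.card_le_card fun l hl => ?_)
    simp only [Finset.mem_filter, Finset.mem_univ, true_and] at hl ⊢
    exact ⟨hl.1, h _ _ hl.2⟩
  exact ⟨hU.diag, fun i => (hle i).trans (hU.row i), fun j => (hle j).trans (hU.col j)⟩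

/-- Adding a row that lies in `U` and a column that does not keeps the pattern balanced. -/
lemma IsBalanced.cons {n : ℕ} {ι : Type*} [DecidableEq ι] {β : Fin n → ι}
    {U : Fin n → Fin n → Bool} (hU : IsBalanced β U) (i : ι)
    (hi : (Finset.univ.filter fun l => β l = i).card + 2 ≤ n) :
    ∃ U', IsBalanced (Fin.cons i β : Fin (n + 1) → ι) U' := by
  have hd0 : demand (Fin.cons i β : Fin (n + 1) → ι) 0 ≤ n := by
    unfold demand
    rw [Fin.card_filter_univ_succ]
    simpa [add_assoc] using hi
  have hds : ∀ a : Fin n, demand (Fin.cons i β : Fin (n + 1) → ι) a.succ = demand β a := by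
    intro a
    unfold demand
    rw [Fin.card_filter_univ_succ]
    simp
  -- The new row and column come first, so the old demands, which count only later positions, do not
  -- change. The new cells serve only the new row and column: `n` for the row and `n + 1` for the
  -- column.
  refine ⟨Fin.cons (Fin.cons false fun _ => true) fun a => Fin.cons false fun b => U a b, ?_, ?_, ?_⟩
  · intro a
    refine Fin.cases (by simp) (fun a => by simpa using hU.diag a) a
  · intro a
    refine Fin.cases ?_ (fun a => ?_) a
    · rw [Fin.card_filter_univ_succ]; simpa using hd0
    · rw [Fin.card_filter_univ_succ, hds]; simpa using hU.row a
  · intro b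
    refine Fin.cases ?_ (fun b => ?_) b
    · rw [Fin.card_filter_univ_succ]
      simpa using hd0.trans (Nat.le_succ n)
    · rw [Fin.card_filter_univ_succ, hds]; simpa using hU.col b

/-- Missing lines are prepended one at a time, by induction on the total shortfall. The margin
`htwo` persists because `n` grows by one while each fibre grows by at most one. -/
lemma IsBalanced.exists_of_le {ι : Type*} [Fintype ι] [DecidableEq ι] (d : ι → ℕ) {n : ℕ}
    {β : Fin n → ι} {U : Fin n → Fin n → Bool} (hU : IsBalanced β U)
    (hle : ∀ i, (Finset.univ.filter fun l => β l = i).card ≤ d i)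
    (htwo : ∀ i, (Finset.univ.filter fun l => β l = i).card + 2 ≤ n) :
    ∃ (n' : ℕ) (β' : Fin n' → ι) (U' : Fin n' → Fin n' → Bool), IsBalanced β' U' ∧
      ∀ i, (Finset.univ.filter fun l => β' l = i).card = d i := by
  induction hN : ∑ i, (d i - (Finset.univ.filter fun l => β l = i).card) generalizing n with
  | zero =>
    refine ⟨n, β, U, hU, fun i => ?_⟩
    have := (Finset.sum_eq_zero_iff.mp hN) i (Finset.mem_univ i)
    have := hle i
    omega
  | succ N ih =>
    obtain ⟨i, -, hi⟩ : ∃ i ∈ Finset.univ,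
        d i - (Finset.univ.filter fun l => β l = i).card ≠ 0 := by
      apply Finset.exists_ne_zero_of_sum_ne_zero; omega
    obtain ⟨U', hU'⟩ := hU.cons i (htwo i)
    have hc : ∀ j, (Finset.univ.filter fun l => (Fin.cons i β : Fin (n + 1) → ι) l = j).card
        = (Finset.univ.filter fun l => β l = j).card + if j = i then 1 else 0 := by
      intro j
      rw [Fin.card_filter_univ_succ]
      by_cases h : j = i
      · subst h; simp
      · simp [h, Ne.symm h]
    refine ih hU' (fun j => ?_) (fun j => ?_) ?_
    · rw [hc]; have := hle j; split_ifs with h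
      · subst h; omega
      · omega
    · rw [hc]; have := htwo j; split_ifs <;> omega
    · have hsplit : ∀ j, d j - (Finset.univ.filter fun l => β l = j).card
          = (d j - (Finset.univ.filter fun l =>
              (Fin.cons i β : Fin (n + 1) → ι) l = j).card) + if j = i then 1 else 0 := by
        intro j; rw [hc]; split_ifs with h
        · subst h; omega
        · omega
      rw [Finset.sum_congr rfl fun j _ => hsplit j, Finset.sum_add_distrib,
        Finset.sum_ite_eq' Finset.univ i, if_pos (Finset.mem_univ i)] at hN
      omega

lemma IsBalanced.exists_of_embedding {ι : Type*} [Fintype ι] [DecidableEq ι] (d : ι → ℕ)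
    {m n : ℕ} {β : Fin n → Fin m} {U : Fin n → Fin n → Bool} (hU : IsBalanced β U)
    (φ : Fin m → ι) (hφ : Function.Injective φ)
    (hle : ∀ j, (Finset.univ.filter fun l => β l = j).card ≤ d (φ j))
    (htwo : ∀ j, (Finset.univ.filter fun l => β l = j).card + 2 ≤ n) (hn : 2 ≤ n) :
    ∃ (n' : ℕ) (β' : Fin n' → ι) (U' : Fin n' → Fin n' → Bool), IsBalanced β' U' ∧
      ∀ i, (Finset.univ.filter fun l => β' l = i).card = d i := by
  have hc : ∀ i, (∃ j, i = φ j ∧ (Finset.univ.filter fun l => φ (β l) = i).card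
      = (Finset.univ.filter fun l => β l = j).card) ∨
      (Finset.univ.filter fun l => φ (β l) = i).card = 0 := by
    intro i
    by_cases h : ∃ j, i = φ j
    · obtain ⟨j, rfl⟩ := h
      exact Or.inl ⟨j, rfl, by simp [hφ.eq_iff]⟩
    · refine Or.inr ?_
      rw [Finset.card_eq_zero, Finset.filter_eq_empty_iff]
      exact fun l _ hl => h ⟨_, hl.symm⟩
  refine (hU.of_imp (β' := fun l => φ (β l)) fun i j h => hφ h).exists_of_le d
    (fun i => ?_) (fun i => ?_)
  · rcases hc i with ⟨j, rfl, h⟩ | h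
    · rw [h]; exact hle j
    · rw [h]; exact Nat.zero_le _
  · rcases hc i with ⟨j, rfl, h⟩ | h
    · rw [h]; exact htwo j
    · rw [h]; omega

/-- This and the following patterns are the starting points for `IsBalanced.exists_of_le`. Their
label multiplicities are the minimal ones with 2p > 3s; the balance conditions are a finite check.
-/
lemma isBalanced_two_two_one :
    IsBalanced (![0, 0, 1, 1, 2] : Fin 5 → Fin 3)
      ![![false, true, true, true, false],
        ![true, false, false, false, true],
        ![false, true, false, true, true],
        ![false, true, false, false, true],
        ![true, false, false, true, false]] :=
  ⟨by decide +kernel, by decide +kernel, by decide +kernel⟩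

lemma isBalanced_five_one_one :
    IsBalanced (![0, 0, 0, 0, 0, 1, 2] : Fin 7 → Fin 3)
      ![![false, true, true, true, true, true, true],
        ![false, false, true, true, true, true, true],
        ![false, false, false, true, true, true, true],
        ![false, false, false, false, true, true, true],
        ![false, false, false, true, false, true, false],
        ![true, true, false, false, false, false, false],
        ![false, false, true, false, true, false, false]] :=
  ⟨by decide +kernel, by decide +kernel, by decide +kernel⟩

lemma isBalanced_four_three :
    IsBalanced (![0, 0, 0, 0, 1, 1, 1] : Fin 7 → Fin 2)
      ![![false, true, true, true, false, true, true],
        ![false, false, true, true, true, false, true],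
        ![false, true, false, true, false, true, false],
        ![false, true, false, false, false, false, true],
        ![false, false, true, true, false, true, true],
        ![true, false, false, false, true, false, true],
        ![false, false, false, false, true, true, false]] :=
  ⟨by decide +kernel, by decide +kernel, by decide +kernel⟩

lemma isBalanced_seven_two :
    IsBalanced (![0, 0, 0, 0, 0, 0, 0, 1, 1] : Fin 9 → Fin 2)
      ![![false, true, true, true, true, true, true, true, true],
        ![false, false, true, true, true, true, true, true, true],
        ![true, false, false, false, true, true, true, true, true],
        ![false, false, false, false, true, true, true, true, true],
        ![false, false, false, false, false, true, true, true, true],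
        ![false, false, false, true, false, false, true, false, true],
        ![false, false, true, false, false, false, false, true, false],
        ![false, true, false, false, false, true, false, false, true],
        ![false, false, false, true, false, false, true, false, false]] :=
  ⟨by decide +kernel, by decide +kernel, by decide +kernel⟩

lemma isBalanced_two_one_one_one :
    ∃ U, IsBalanced (![0, 0, 1, 2, 3] : Fin 5 → Fin 4) U :=
  ⟨_, isBalanced_two_two_one.of_imp (by decide +kernel)⟩

lemma isBalanced_one_one_one_one_one :
    ∃ U, IsBalanced (![0, 1, 2, 3, 4] : Fin 5 → Fin 5) U :=
  ⟨_, isBalanced_two_two_one.of_imp (by decide +kernel)⟩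

/-- If `2p > 3s`, there is a balanced pattern whose labels are the indices `i ≠ 0`,
each used `d i` times. -/
lemma exists_isBalanced {r : ℕ} [hne : NeZero r] (hr : 2 < r) (d : Fin r → ℕ) (hanti : Antitone d)
    (hpos : ∀ i, 1 ≤ d i) (hps : 3 * s d < 2 * p d) :
    ∃ (n : ℕ) (β : Fin n → Fin r) (U : Fin n → Fin n → Bool), IsBalanced β U ∧
      ∀ i, (Finset.univ.filter fun l => β l = i).card = Function.update d 0 0 i := by
  have hcast : ∀ m (h : m + 1 ≤ r), Function.Injective (fun j : Fin m => (⟨j + 1, by omega⟩ : Fin r)) := by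
    intro m h a b hab
    simpa [Fin.ext_iff] using hab
  have hupd : ∀ m (h : m + 1 ≤ r) (j : Fin m),
      Function.update d 0 0 (⟨j + 1, by omega⟩ : Fin r) = d ⟨j + 1, by omega⟩ := by
    intro m h j
    rw [Function.update_of_ne]
    simp [Fin.ext_iff]
  rcases (show r = 3 ∨ r = 4 ∨ r = 5 ∨ 6 ≤ r by omega) with rfl | rfl | rfl | h6
  · obtain rfl : hne = Nat.instNeZeroSucc := rfl
    have hs : s d = d 1 + d 2 := by
      rw [s, show Finset.Ioi (0 : Fin 3) = {1, 2} by decide]; simp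
    have hp : p d = d 1 * d 2 := by
      rw [p, show Finset.Ioi (0 : Fin 3) = {1, 2} by decide]; simp [show Finset.Ioi (1 : Fin 3) = {2} by decide, show Finset.Ioi (2 : Fin 3) = ∅ by decide]
    rw [hs, hp] at hps
    have h12 : d 2 ≤ d 1 := hanti (by decide)
    -- The pairs (6, 2) and (3, 3) give 2p = 3s, and a part equal to 1 never suffices.
    have : (7 ≤ d 1 ∧ 2 ≤ d 2) ∨ (4 ≤ d 1 ∧ 3 ≤ d 2) := by
      rcases (show d 2 ≤ 1 ∨ d 2 = 2 ∨ 3 ≤ d 2 by omega) with h | h | h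
      · nlinarith
      · rw [h] at hps; omega
      · refine Or.inr ⟨?_, h⟩
        by_contra h4
        have e1 : d 1 = 3 := by omega
        have e2 : d 2 = 3 := by omega
        rw [e1, e2] at hps; omega
    rcases this with ⟨h1, h2⟩ | ⟨h1, h2⟩
    · refine isBalanced_seven_two.exists_of_embedding _ _ (hcast 2 (by omega)) (fun j => ?_)
        (by decide +kernel) (by omega)
      rw [hupd 2 (by omega)]
      fin_cases j
      · exact le_trans (by decide +kernel) h1
      · exact le_trans (by decide +kernel) h2
    · refine isBalanced_four_three.exists_of_embedding _ _ (hcast 2 (by omega)) (fun j => ?_)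
        (by decide +kernel) (by omega)
      rw [hupd 2 (by omega)]
      fin_cases j
      · exact le_trans (by decide +kernel) h1
      · exact le_trans (by decide +kernel) h2
  · obtain rfl : hne = Nat.instNeZeroSucc := rfl
    have hs : s d = d 1 + (d 2 + d 3) := by
      rw [s, show Finset.Ioi (0 : Fin 4) = {1, 2, 3} by decide]; simp
    have hp : p d = d 1 * d 2 + d 1 * d 3 + d 2 * d 3 := by
      rw [p, show Finset.Ioi (0 : Fin 4) = {1, 2, 3} by decide]; simp [show Finset.Ioi (1 : Fin 4) = {2, 3} by decide, show Finset.Ioi (2 : Fin 4) = {3} by decide,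
        show Finset.Ioi (3 : Fin 4) = ∅ by decide]
    rw [hs, hp] at hps
    have h12 : d 2 ≤ d 1 := hanti (by decide)
    have h23 : d 3 ≤ d 2 := hanti (by decide)
    have h3 := hpos 3
    by_cases h2 : 2 ≤ d 2
    · refine isBalanced_two_two_one.exists_of_embedding _ _ (hcast 3 (by omega)) (fun j => ?_)
        (by decide +kernel) (by omega)
      rw [hupd 3 (by omega)]
      fin_cases j
      · exact le_trans (by decide +kernel) (h2.trans h12)
      · exact le_trans (by decide +kernel) h2
      · exact le_trans (by decide +kernel) h3
    -- For parts (a, 1, 1) the inequality reads 4a + 2 > 3a + 6, that is a ≥ 5.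
    · have e2 : d 2 = 1 := by omega
      have e3 : d 3 = 1 := by omega
      rw [e2, e3] at hps
      have h1 : 5 ≤ d 1 := by omega
      refine isBalanced_five_one_one.exists_of_embedding _ _ (hcast 3 (by omega)) (fun j => ?_)
        (by decide +kernel) (by omega)
      rw [hupd 3 (by omega)]
      fin_cases j
      · exact le_trans (by decide +kernel) h1
      · exact le_trans (by decide +kernel) (hpos 2)
      · exact le_trans (by decide +kernel) h3
  · obtain rfl : hne = Nat.instNeZeroSucc := rfl
    have hs : s d = d 1 + (d 2 + (d 3 + d 4)) := by
      rw [s, show Finset.Ioi (0 : Fin 5) = {1, 2, 3, 4} by decide]; simp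
    have hp : p d = d 1 * d 2 + d 1 * d 3 + d 1 * d 4 + d 2 * d 3 + d 2 * d 4 + d 3 * d 4 := by
      rw [p, show Finset.Ioi (0 : Fin 5) = {1, 2, 3, 4} by decide]; simp [show Finset.Ioi (1 : Fin 5) = {2, 3, 4} by decide,
        show Finset.Ioi (2 : Fin 5) = {3, 4} by decide,
        show Finset.Ioi (3 : Fin 5) = {4} by decide, show Finset.Ioi (4 : Fin 5) = ∅ by decide]
      ring
    rw [hs, hp] at hps
    -- Four parts equal to 1 give 2p = 3s = 12.
    have h1 : 2 ≤ d 1 := by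
      by_contra h1
      have e1 : d 1 = 1 := by have := hpos 1; omega
      have h12 : d 2 ≤ d 1 := hanti (by decide)
      have h13 : d 3 ≤ d 1 := hanti (by decide)
      have h14 : d 4 ≤ d 1 := hanti (by decide)
      have e2 : d 2 = 1 := by have := hpos 2; omega
      have e3 : d 3 = 1 := by have := hpos 3; omega
      have e4 : d 4 = 1 := by have := hpos 4; omega
      rw [e1, e2, e3, e4] at hps; omega
    obtain ⟨U, hU⟩ := isBalanced_two_one_one_one
    refine hU.exists_of_embedding _ _ (hcast 4 (by omega)) (fun j => ?_)
        (by decide +kernel) (by omega)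
    rw [hupd 4 (by omega)]
    fin_cases j
    · exact le_trans (by decide +kernel) h1
    · exact le_trans (by decide +kernel) (hpos 2)
    · exact le_trans (by decide +kernel) (hpos 3)
    · exact le_trans (by decide +kernel) (hpos 4)
  · obtain ⟨U, hU⟩ := isBalanced_one_one_one_one_one
    refine hU.exists_of_embedding _ _ (hcast 5 (by omega)) (fun j => ?_)
        (by decide +kernel) (by omega)
    rw [hupd 5 (by omega)]
    refine le_trans ?_ (hpos _)
    revert j
    decide +kernel

end Balanced

/-! ### Polynomial dependence on the coefficients of the forms -/

section Polynomiality

variable {k : Type*} [Field k] {r : ℕ} {d : Fin r → ℕ}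

/-- A function of pairs of tuples of forms that is polynomial in their coefficients. -/
def IsCoordPoly (f : FormTuple k d → FormTuple k d → k) : Prop :=
  ∃ Φ : MvPolynomial ((Fin r × (Fin 3 →₀ ℕ)) ⊕ (Fin r × (Fin 3 →₀ ℕ))) k,
    ∀ F G : FormTuple k d, f F G = eval (Sum.elim F.coords G.coords) Φ

lemma IsCoordPoly.const (c : k) : IsCoordPoly fun _ _ : FormTuple k d => c :=
  ⟨C c, fun _ _ => by simp⟩

lemma IsCoordPoly.add {f g : FormTuple k d → FormTuple k d → k} (hf : IsCoordPoly f)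
    (hg : IsCoordPoly g) : IsCoordPoly fun F G => f F G + g F G := by
  obtain ⟨Φ, hΦ⟩ := hf
  obtain ⟨Ψ, hΨ⟩ := hg
  exact ⟨Φ + Ψ, fun F G => by simp only [map_add, hΦ, hΨ]⟩

lemma IsCoordPoly.mul {f g : FormTuple k d → FormTuple k d → k} (hf : IsCoordPoly f)
    (hg : IsCoordPoly g) : IsCoordPoly fun F G => f F G * g F G := by
  obtain ⟨Φ, hΦ⟩ := hf
  obtain ⟨Ψ, hΨ⟩ := hg
  exact ⟨Φ * Ψ, fun F G => by simp only [map_mul, hΦ, hΨ]⟩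

lemma IsCoordPoly.sum {α : Type*} (S : Finset α) {f : α → FormTuple k d → FormTuple k d → k}
    (hf : ∀ a, IsCoordPoly (f a)) : IsCoordPoly fun F G => ∑ a ∈ S, f a F G := by
  choose Φ hΦ using hf
  exact ⟨∑ a ∈ S, Φ a, fun F G => by rw [map_sum]; exact Finset.sum_congr rfl fun a _ => hΦ a F G⟩

lemma IsCoordPoly.prod {α : Type*} (S : Finset α) {f : α → FormTuple k d → FormTuple k d → k}
    (hf : ∀ a, IsCoordPoly (f a)) : IsCoordPoly fun F G => ∏ a ∈ S, f a F G := by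
  choose Φ hΦ using hf
  exact ⟨∏ a ∈ S, Φ a, fun F G => by rw [map_prod]; exact Finset.prod_congr rfl fun a _ => hΦ a F G⟩

lemma IsCoordPoly.det {n : ℕ} {M : FormTuple k d → FormTuple k d → Matrix (Fin n) (Fin n) k}
    (hM : ∀ i j, IsCoordPoly fun F G => M F G i j) : IsCoordPoly fun F G => (M F G).det := by
  simp only [Matrix.det_apply']
  exact IsCoordPoly.sum _ fun σ => (IsCoordPoly.const _).mul (IsCoordPoly.prod _ fun i => hM _ _)

/-- A polynomial-valued function of pairs of tuples of forms all of whose coefficients are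
polynomial in the coefficients of the forms. -/
def IsCoeffPoly (P : FormTuple k d → FormTuple k d → MvPolynomial (Fin 3) k) : Prop :=
  ∀ m, IsCoordPoly fun F G => coeff m (P F G)

lemma IsCoeffPoly.const (P : MvPolynomial (Fin 3) k) :
    IsCoeffPoly fun _ _ : FormTuple k d => P := fun _ => IsCoordPoly.const _

lemma IsCoeffPoly.left (i : Fin r) :
    IsCoeffPoly fun F _ : FormTuple k d => (F i : MvPolynomial (Fin 3) k) :=
  fun m => ⟨X (Sum.inl (i, m)), fun F G => by simp [FormTuple.coords]⟩

lemma IsCoeffPoly.right (i : Fin r) :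
    IsCoeffPoly fun _ G : FormTuple k d => (G i : MvPolynomial (Fin 3) k) :=
  fun m => ⟨X (Sum.inr (i, m)), fun F G => by simp [FormTuple.coords]⟩

lemma IsCoeffPoly.mul {P Q : FormTuple k d → FormTuple k d → MvPolynomial (Fin 3) k}
    (hP : IsCoeffPoly P) (hQ : IsCoeffPoly Q) : IsCoeffPoly fun F G => P F G * Q F G := by
  intro m
  simp only [coeff_mul]
  exact IsCoordPoly.sum _ fun a => (hP a.1).mul (hQ a.2)

lemma IsCoeffPoly.prod {α : Type*} (S : Finset α)
    {P : α → FormTuple k d → FormTuple k d → MvPolynomial (Fin 3) k}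
    (hP : ∀ a, IsCoeffPoly (P a)) : IsCoeffPoly fun F G => ∏ a ∈ S, P a F G := by
  classical
  induction S using Finset.induction_on with
  | empty => simpa using IsCoeffPoly.const 1
  | insert a S ha ih => simpa only [Finset.prod_insert ha] using (hP a).mul ih

lemma IsCoeffPoly.sum {α : Type*} (S : Finset α)
    {P : α → FormTuple k d → FormTuple k d → MvPolynomial (Fin 3) k}
    (hP : ∀ a, IsCoeffPoly (P a)) : IsCoeffPoly fun F G => ∑ a ∈ S, P a F G := by
  intro m
  simp only [coeff_sum]
  exact IsCoordPoly.sum _ fun a => hP a m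

lemma IsCoeffPoly.sub {P Q : FormTuple k d → FormTuple k d → MvPolynomial (Fin 3) k}
    (hP : IsCoeffPoly P) (hQ : IsCoeffPoly Q) : IsCoeffPoly fun F G => P F G - Q F G := by
  intro m
  have h : ∀ F G, coeff m (P F G - Q F G) = coeff m (P F G) + -1 * coeff m (Q F G) := by
    intro F G
    rw [coeff_sub]; ring
  simp only [h]
  exact (hP m).add ((IsCoordPoly.const _).mul (hQ m))

end Polynomiality

/-! ### The maps T_F, their kernels and semicontinuity -/

section Forms

variable {k : Type*} [Field k]

instance finite_homogeneousSubmodule (n : ℕ) :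
    Module.Finite k (homogeneousSubmodule (Fin 3) k n) :=
  Module.Finite.iff_fg.mpr (homogeneousSubmodule_fg (Fin 3) k n)

lemma finrank_homogeneousSubmodule (n : ℕ) :
    Module.finrank k (homogeneousSubmodule (Fin 3) k n) = (n + 2).choose 2 := by
  have e := (LinearEquiv.ofEq _ _ (homogeneousSubmodule_eq_finsupp_supported (Fin 3) k n)).trans
    (AddMonoidAlgebra.supportedEquivFinsupp {m : Fin 3 →₀ ℕ | m.degree = n})
  have hset : {m : Fin 3 →₀ ℕ | m.degree = n}
      = ((Finset.univ : Finset (Fin 3)).finsuppAntidiag n : Set (Fin 3 →₀ ℕ)) := by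
    ext m
    simp [Finset.mem_finsuppAntidiag, Finsupp.degree_eq_sum]
  rw [LinearEquiv.finrank_eq e, hset, Module.finrank_finsupp_self]
  simp only [Finset.coe_sort_coe, Fintype.card_coe]
  rw [Finset.card_finsuppAntidiag_nat_eq_choose, Finset.card_univ, Fintype.card_fin,
    show 3 + n - 1 = n + 2 by omega, Nat.choose_symm_add]

variable {r : ℕ} {d : Fin r → ℕ}

/-- The product of all the forms but the `i`-th one. -/
noncomputable def cofactor (F : FormTuple k d) (i : Fin r) : MvPolynomial (Fin 3) k :=
  ∏ j ∈ Finset.univ.erase i, (F j : MvPolynomial (Fin 3) k)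

lemma mul_cofactor (F : FormTuple k d) (i : Fin r) :
    (F i : MvPolynomial (Fin 3) k) * cofactor F i = ∏ j, (F j : MvPolynomial (Fin 3) k) :=
  Finset.mul_prod_erase Finset.univ (fun j => (F j : MvPolynomial (Fin 3) k)) (Finset.mem_univ i)

lemma cofactor_isHomogeneous (F : FormTuple k d) (i : Fin r) :
    (cofactor F i).IsHomogeneous (∑ j ∈ Finset.univ.erase i, d j) :=
  IsHomogeneous.prod _ _ _ fun j _ => (F j).2

lemma add_sum_erase_eq_totalDeg (i : Fin r) :
    d i + ∑ j ∈ Finset.univ.erase i, d j = totalDeg d :=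
  Finset.add_sum_erase Finset.univ d (Finset.mem_univ i)

/-- The map `(H₁, …, H_r) ↦ ∑ H_i F / F_i`. -/
noncomputable def tangentMap (F : FormTuple k d) : FormTuple k d →ₗ[k] MvPolynomial (Fin 3) k :=
  ∑ i, (LinearMap.mulRight k (cofactor F i)) ∘ₗ (Submodule.subtype _) ∘ₗ (LinearMap.proj i)

lemma tangentMap_apply (F H : FormTuple k d) :
    tangentMap F H = ∑ i, (H i : MvPolynomial (Fin 3) k) * cofactor F i := by
  simp [tangentMap]

lemma tangentMap_isHomogeneous (F H : FormTuple k d) :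
    (tangentMap F H).IsHomogeneous (totalDeg d) := by
  rw [tangentMap_apply]
  refine IsHomogeneous.sum _ _ _ fun i _ => ?_
  rw [← add_sum_erase_eq_totalDeg i]
  exact IsHomogeneous.mul (H i).2 (cofactor_isHomogeneous F i)

/-- The generators are homogeneous, so in degree `totalDeg d` each coefficient of an ideal
combination may be replaced by its component of degree `d i`. -/
lemma range_tangentMap (F : FormTuple k d) :
    LinearMap.range (tangentMap F) = degreePart (idealY F) (totalDeg d) := by
  ext P
  simp only [degreePart, Submodule.mem_inf, Submodule.restrictScalars_mem,
    mem_homogeneousSubmodule, LinearMap.mem_range]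
  constructor
  · rintro ⟨H, rfl⟩
    refine ⟨?_, tangentMap_isHomogeneous F H⟩
    rw [tangentMap_apply]
    exact Ideal.sum_mem _ fun i _ => Ideal.mul_mem_left _ _ (Ideal.subset_span ⟨i, rfl⟩)
  · rintro ⟨hP, hdeg⟩
    obtain ⟨c, hc⟩ := (Ideal.mem_span_range_iff_exists_fun).mp hP
    refine ⟨fun i => ⟨homogeneousComponent (d i) (c i), homogeneousComponent_mem _ _⟩, ?_⟩
    rw [tangentMap_apply, ← homogeneousComponent_eq_self hdeg, ← hc, map_sum]
    refine Finset.sum_congr rfl fun i _ => ?_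
    rw [← add_sum_erase_eq_totalDeg i, mul_comm (c i), add_comm (d i)]
    exact (mul_comm _ _).trans
      (homogeneousComponent_mul_of_isHomogeneous (cofactor_isHomogeneous F i) _ _).symm

lemma degreePart_idealZ (F G : FormTuple k d) :
    degreePart (idealZ F G) (totalDeg d)
      = LinearMap.range (tangentMap F) ⊓ LinearMap.range (tangentMap G) := by
  rw [range_tangentMap, range_tangentMap]
  ext P
  simp only [degreePart, idealZ, Submodule.mem_inf, Submodule.restrictScalars_mem]
  tauto

/-- The map `(H, K) ↦ ∑ H_i F / F_i - ∑ K_i G / G_i`. -/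
noncomputable def differenceMap (F G : FormTuple k d) :
    FormTuple k d × FormTuple k d →ₗ[k] MvPolynomial (Fin 3) k :=
  tangentMap F ∘ₗ LinearMap.fst k _ _ - tangentMap G ∘ₗ LinearMap.snd k _ _

lemma differenceMap_apply (F G H K : FormTuple k d) :
    differenceMap F G (H, K) = tangentMap F H - tangentMap G K := by
  simp [differenceMap]

/-- The kernel on the right is the fibre product of `f` and `g`. It maps onto the intersection of
the ranges, and the kernel of that map contains ker f × ker g. -/
lemma finrank_range_inf_range_le {V V' W : Type*} [AddCommGroup V] [AddCommGroup V']
    [AddCommGroup W] [Module k V] [Module k V'] [Module k W] [Module.Finite k V]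
    [Module.Finite k V'] (f : V →ₗ[k] W) (g : V' →ₗ[k] W) :
    Module.finrank k (LinearMap.range f ⊓ LinearMap.range g : Submodule k W)
      + (Module.finrank k (LinearMap.ker f) + Module.finrank k (LinearMap.ker g))
      ≤ Module.finrank k (LinearMap.ker (f ∘ₗ LinearMap.fst k V V' - g ∘ₗ LinearMap.snd k V V')) := by
  set N := LinearMap.ker (f ∘ₗ LinearMap.fst k V V' - g ∘ₗ LinearMap.snd k V V') with hN
  have hmem : ∀ z, z ∈ N ↔ f z.1 = g z.2 := fun z => by simp [hN, sub_eq_zero]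
  let L : N →ₗ[k] W := (f ∘ₗ LinearMap.fst k V V').domRestrict N
  have hrange : LinearMap.range L = LinearMap.range f ⊓ LinearMap.range g := by
    ext w
    constructor
    · rintro ⟨⟨z, hz⟩, rfl⟩
      exact ⟨⟨z.1, rfl⟩, ⟨z.2, ((hmem z).mp hz).symm⟩⟩
    · rintro ⟨⟨v, hv⟩, ⟨v', hv'⟩⟩
      exact ⟨⟨(v, v'), (hmem _).mpr (hv.trans hv'.symm)⟩, hv⟩
  have hker : Module.finrank k (LinearMap.ker f) + Module.finrank k (LinearMap.ker g)
      ≤ Module.finrank k (LinearMap.ker L) := by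
    rw [← Module.finrank_prod]
    let J : (LinearMap.ker f × LinearMap.ker g) →ₗ[k] V × V' :=
      (LinearMap.ker f).subtype.prodMap (LinearMap.ker g).subtype
    have hJ : ∀ z, J z ∈ N := fun z => (hmem _).mpr (by
      change f z.1 = g z.2
      rw [LinearMap.mem_ker.mp z.1.2, LinearMap.mem_ker.mp z.2.2])
    have hJL : ∀ z, J.codRestrict N hJ z ∈ LinearMap.ker L := fun z => by
      change f z.1 = 0
      exact z.1.2
    refine LinearMap.finrank_le_finrank_of_injective
      (f := (J.codRestrict N hJ).codRestrict (LinearMap.ker L) hJL) ?_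
    intro a b hab
    have h1 : J a = J b := congrArg (fun z => ((z : N) : V × V')) (congrArg Subtype.val hab)
    refine Prod.ext (Subtype.ext ?_) (Subtype.ext ?_)
    · exact congrArg Prod.fst h1
    · exact congrArg Prod.snd h1
  have := LinearMap.finrank_range_add_finrank_ker L
  rw [hrange] at this
  omega

/-- The map `c ↦ (c₁ F₁, …, c_r F_r)`. -/
noncomputable def scaleMap (F : FormTuple k d) : (Fin r → k) →ₗ[k] FormTuple k d :=
  LinearMap.pi fun i => (LinearMap.toSpanSingleton k _ (F i)) ∘ₗ LinearMap.proj i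

lemma scaleMap_apply (F : FormTuple k d) (c : Fin r → k) (i : Fin r) :
    scaleMap F c i = c i • F i := rfl

/-- The tuples `(c₁ F₁, …, c_r F_r)` with `∑ c_i = 0`. -/
noncomputable def trivialRelations (F : FormTuple k d) : Submodule k (FormTuple k d) :=
  (LinearMap.ker (∑ i, LinearMap.proj i : (Fin r → k) →ₗ[k] k)).map (scaleMap F)

lemma finrank_ker_sum_proj [NeZero r] :
    Module.finrank k (LinearMap.ker (∑ i, LinearMap.proj i : (Fin r → k) →ₗ[k] k)) = r - 1 := by
  set σ := (∑ i, LinearMap.proj i : (Fin r → k) →ₗ[k] k) with hσ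
  have hsurj : LinearMap.range σ = ⊤ := by
    rw [LinearMap.range_eq_top]
    intro c
    exact ⟨Pi.single 0 c, by simp [hσ]⟩
  have := LinearMap.finrank_range_add_finrank_ker σ
  rw [hsurj, finrank_top, Module.finrank_self, Module.finrank_fin_fun] at this
  omega

lemma finrank_trivialRelations_le [NeZero r] (F : FormTuple k d) :
    Module.finrank k (trivialRelations F) ≤ r - 1 :=
  (Submodule.finrank_map_le _ _).trans finrank_ker_sum_proj.le

lemma trivialRelations_le_ker (F : FormTuple k d) :
    trivialRelations F ≤ LinearMap.ker (tangentMap F) := by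
  rintro _ ⟨c, hc, rfl⟩
  have hc' : ∑ i, c i = 0 := by simpa using hc
  rw [LinearMap.mem_ker, tangentMap_apply]
  have : ∀ i, (scaleMap F c i : MvPolynomial (Fin 3) k) * cofactor F i
      = c i • ∏ j, (F j : MvPolynomial (Fin 3) k) := by
    intro i
    rw [scaleMap_apply, Submodule.coe_smul, smul_mul_assoc, mul_cofactor]
  rw [Finset.sum_congr rfl fun i _ => this i, ← Finset.sum_smul, hc', zero_smul]

lemma le_finrank_ker_tangentMap [NeZero r] (F : FormTuple k d) (hF : ∀ i, F i ≠ 0) :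
    r - 1 ≤ Module.finrank k (LinearMap.ker (tangentMap F)) := by
  have hinj : Function.Injective (scaleMap F) := by
    intro a b hab
    funext i
    exact smul_left_injective k (hF i) (congrFun hab i)
  rw [← finrank_ker_sum_proj (k := k) (r := r),
    (Submodule.equivMapOfInjective (scaleMap F) hinj _).finrank_eq]
  exact Submodule.finrank_mono (trivialRelations_le_ker F)

/-- Upper semicontinuity of the dimension of the kernel of `differenceMap F G`. -/
lemma exists_isCoordPoly_finrank_ker_le (F₀ G₀ : FormTuple k d) :
    ∃ f : FormTuple k d → FormTuple k d → k, IsCoordPoly f ∧ f F₀ G₀ ≠ 0 ∧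
      ∀ F G, f F G ≠ 0 → Module.finrank k (LinearMap.ker (differenceMap F G))
        ≤ Module.finrank k (LinearMap.ker (differenceMap F₀ G₀)) := by
  classical
  let S := (Finset.univ : Finset (Fin 3)).finsuppAntidiag (totalDeg d)
  let c : MvPolynomial (Fin 3) k →ₗ[k] (S → k) := LinearMap.pi fun m => lcoeff k m.1
  have hc : ∀ P m, c P m = coeff m.1 P := fun P m => rfl
  -- All values are forms of degree `totalDeg d`, so finitely many coefficients determine them and
  -- the target may be taken finite-dimensional.
  have hcker : ∀ F G : FormTuple k d, LinearMap.ker (c ∘ₗ differenceMap F G)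
      = LinearMap.ker (differenceMap F G) := by
    intro F G
    refine le_antisymm (fun z hz => ?_) (LinearMap.ker_le_ker_comp _ _)
    obtain ⟨H, K⟩ := z
    rw [LinearMap.mem_ker, differenceMap_apply]
    have hhom := (tangentMap_isHomogeneous F H).sub (tangentMap_isHomogeneous G K)
    ext m
    by_cases hm : m.degree = totalDeg d
    · have hmS : m ∈ S := by simpa [S, Finset.mem_finsuppAntidiag, Finsupp.degree_eq_sum] using hm
      have := congrFun (LinearMap.mem_ker.mp hz) ⟨m, hmS⟩
      simpa [hc, differenceMap_apply] using this
    · rw [hhom.coeff_eq_zero hm, coeff_zero]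
  have hpoly : ∀ z, IsCoeffPoly fun F G : FormTuple k d => differenceMap F G z := by
    rintro ⟨H, K⟩
    simp only [differenceMap_apply, tangentMap_apply, cofactor]
    exact (IsCoeffPoly.sum _ fun i => (IsCoeffPoly.const _).mul
      (IsCoeffPoly.prod _ fun j => IsCoeffPoly.left j)).sub
      (IsCoeffPoly.sum _ fun i => (IsCoeffPoly.const _).mul
      (IsCoeffPoly.prod _ fun j => IsCoeffPoly.right j))
  set L₀ := c ∘ₗ differenceMap F₀ G₀ with hL₀
  set n := Module.finrank k (LinearMap.range L₀) with hn
  let e := (Module.finBasis k (LinearMap.range L₀)).equivFun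
  -- With coordinates `π` on the range of `L₀` and preimages `a j` of the basis, the matrix of the
  -- values at the `a j` is the identity at `(F₀, G₀)`. Wherever its determinant is nonzero, the
  -- rank is at least `n`.
  obtain ⟨π, hπ⟩ := LinearMap.exists_extend (e : LinearMap.range L₀ →ₗ[k] (Fin n → k))
  choose a ha using fun j : Fin n => (e.symm (Pi.single j 1)).2
  have hπa : ∀ j, π (L₀ (a j)) = Pi.single j 1 := by
    intro j
    have : π ((e.symm (Pi.single j 1) : LinearMap.range L₀) : S → k)
        = e (e.symm (Pi.single j 1)) := LinearMap.congr_fun hπ _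
    rw [ha, this, LinearEquiv.apply_symm_apply]
  let M : FormTuple k d → FormTuple k d → Matrix (Fin n) (Fin n) k :=
    fun F G => Matrix.of fun i j => π (c (differenceMap F G (a j))) i
  refine ⟨fun F G => (M F G).det, IsCoordPoly.det fun i j => ?_, ?_, fun F G hFG => ?_⟩
  · have : ∀ F G, M F G i j = ∑ m : S, coeff m.1 (differenceMap F G (a j))
        * π (fun l => if m = l then 1 else 0) i := by
      intro F G
      change π (c (differenceMap F G (a j))) i = _
      rw [LinearMap.pi_apply_eq_sum_univ π, Finset.sum_apply]
      rfl
    simp only [this]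
    exact IsCoordPoly.sum _ fun m => (hpoly _ _).mul (IsCoordPoly.const _)
  · have : M F₀ G₀ = 1 := by
      ext i j
      change π (L₀ (a j)) i = _
      rw [hπa, Matrix.one_apply, Pi.single_apply]
    simp [this]
  · set L := c ∘ₗ differenceMap F G with hL
    have hsurj : LinearMap.range (π ∘ₗ L) = ⊤ := by
      rw [LinearMap.range_eq_top]
      intro w
      have hu : IsUnit (M F G).det := isUnit_iff_ne_zero.mpr hFG
      refine ⟨∑ j, ((M F G)⁻¹.mulVec w) j • a j, ?_⟩
      have : (M F G).mulVec ((M F G)⁻¹.mulVec w) = w := by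
        rw [Matrix.mulVec_mulVec, Matrix.mul_nonsing_inv _ hu, Matrix.one_mulVec]
      conv_rhs => rw [← this]
      rw [map_sum]
      funext i
      rw [Finset.sum_apply]
      simp only [map_smul, Pi.smul_apply, smul_eq_mul]
      exact Finset.sum_congr rfl fun j _ => mul_comm _ _
    have h1 : n ≤ Module.finrank k (LinearMap.range L) := by
      have h2 : Module.finrank k (LinearMap.range (π ∘ₗ L)) = n := by
        rw [hsurj, finrank_top, Module.finrank_fin_fun]
      have h3 := Submodule.finrank_map_le π (LinearMap.range L)
      rw [← LinearMap.range_comp] at h3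
      exact h2.symm.le.trans h3
    have e1 := LinearMap.finrank_range_add_finrank_ker L
    have e0 := LinearMap.finrank_range_add_finrank_ker L₀
    rw [hL, hcker] at e1
    rw [hL₀, hcker] at e0
    rw [← hL] at e1
    rw [← hL₀, ← hn] at e0
    omega

end Forms

/-! ### The invariants after separating the first degree -/

section Degrees

variable {r : ℕ} [NeZero r] (d : Fin r → ℕ)

lemma erase_zero_eq_Ioi : (Finset.univ : Finset (Fin r)).erase 0 = Finset.Ioi 0 := by
  ext i
  simp [Fin.pos_iff_ne_zero']

lemma sum_erase_zero : ∑ j ∈ Finset.univ.erase (0 : Fin r), d j = s d := by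
  rw [erase_zero_eq_Ioi, s]

lemma totalDeg_eq : totalDeg d = d 0 + s d := by
  rw [← sum_erase_zero, add_sum_erase_eq_totalDeg]

lemma D_eq : D d = d 0 * s d + p d := by
  rw [D, ← Finset.add_sum_erase _ _ (Finset.mem_univ (0 : Fin r)), erase_zero_eq_Ioi, p, s,
    Finset.mul_sum]

end Degrees

/-! ### A pair built from two pencils of lines -/

section Example

variable {k : Type*} [Field k] {r : ℕ} {d : Fin r → ℕ} [NeZero r]

/-- Multiplication by a form, as a map between spaces of forms. -/
noncomputable def mulForm {a b c : ℕ} {Q : MvPolynomial (Fin 3) k} (hQ : Q.IsHomogeneous c)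
    (h : a + c = b) : homogeneousSubmodule (Fin 3) k a →ₗ[k] homogeneousSubmodule (Fin 3) k b :=
  (LinearMap.mulRight k Q ∘ₗ Submodule.subtype _).codRestrict _ fun P => by
    subst h; exact IsHomogeneous.mul P.2 hQ

lemma mulForm_apply {a b c : ℕ} {Q : MvPolynomial (Fin 3) k} (hQ : Q.IsHomogeneous c)
    (h : a + c = b) (P : homogeneousSubmodule (Fin 3) k a) :
    (mulForm hQ h P : MvPolynomial (Fin 3) k) = P * Q := rfl

lemma cofactor_zero_isHomogeneous (F : FormTuple k d) : (cofactor F 0).IsHomogeneous (s d) :=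
  sum_erase_zero d ▸ cofactor_isHomogeneous F 0

lemma tangentMap_single (F : FormTuple k d) (P : homogeneousSubmodule (Fin 3) k (d 0)) :
    tangentMap F (Pi.single 0 P) = P * cofactor F 0 := by
  rw [tangentMap_apply, Finset.sum_eq_single_of_mem 0 (Finset.mem_univ _)]
  · simp
  · intro i _ hi
    simp [Pi.single_eq_of_ne hi]

/-- The scalars at the indices other than 0 are completed by minus their sum at index 0, which makes
a trivial relation. -/
lemma exists_trivialRelation_add_single (F H : FormTuple k d)
    (h : ∀ i, i ≠ 0 → ∃ c : k, H i = c • F i) :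
    ∃ T ∈ trivialRelations F, ∃ P, H = T + Pi.single 0 P := by
  choose c hc using h
  let e : Fin r → k := fun i => if hi : i = 0 then 0 else c i hi
  let e' : Fin r → k := e - Pi.single 0 (∑ i, e i)
  refine ⟨scaleMap F e', ⟨e', ?_, rfl⟩, H 0 - e' 0 • F 0, ?_⟩
  · simp [e']
  · funext i
    by_cases hi : i = 0
    · subst hi; simp [scaleMap_apply]
    · rw [Pi.add_apply, Pi.single_eq_of_ne hi, add_zero, scaleMap_apply, hc i hi]
      simp [e', e, hi]

/-- Tuples whose forms of positive index are products of prescribed lines of a pencil. -/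
lemma exists_formTuple (i : Fin 3) {n : ℕ} (β : Fin n → Fin r) (x : Fin n → k)
    (hβ : ∀ j, (Finset.univ.filter fun l => β l = j).card = Function.update d 0 0 j)
    {Q : MvPolynomial (Fin 3) k} (hQ : Q.IsHomogeneous (d 0)) :
    ∃ F : FormTuple k d, (F 0 : MvPolynomial (Fin 3) k) = Q ∧ ∀ j, j ≠ 0 →
      (F j : MvPolynomial (Fin 3) k)
        = ∏ l ∈ Finset.univ.filter (fun l => β l = j), line i (x l) := by
  refine ⟨fun j => if hj : j = 0 then ⟨Q, by subst hj; exact hQ⟩ else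
    ⟨∏ l ∈ Finset.univ.filter (fun l => β l = j), line i (x l), ?_⟩, by simp, fun j hj => by
      simp [hj]⟩
  have := prod_line_isHomogeneous i (Finset.univ.filter fun l => β l = j) x
  rwa [hβ, Function.update_of_ne hj] at this

lemma cofactor_zero_eq (i : Fin 3) {n : ℕ} {β : Fin n → Fin r} (hβ : ∀ l, β l ≠ 0) (x : Fin n → k)
    {F : FormTuple k d} (hF : ∀ j, j ≠ 0 → (F j : MvPolynomial (Fin 3) k)
        = ∏ l ∈ Finset.univ.filter (fun l => β l = j), line i (x l)) :
    cofactor F 0 = ∏ l, line i (x l) := by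
  rw [cofactor, Finset.prod_congr rfl fun j hj => hF j (Finset.ne_of_mem_erase hj)]
  exact Finset.prod_fiberwise_of_maps_to
    (fun l _ => Finset.mem_erase.mpr ⟨hβ l, Finset.mem_univ _⟩) _

/-- On line `l` the form `F (β l)` vanishes, which kills every term but one. In that term the other
products of lines are constant along the line, since they come from the same pencil; only `F 0` and
`H (β l)` depend on `t`. -/
lemma exists_eval_tangentMap {i : Fin 3} (hi : i ≠ 2) {n : ℕ} {β : Fin n → Fin r}
    (hβ : ∀ l, β l ≠ 0) {x : Fin n → k} (hx : Function.Injective x)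
    {F : FormTuple k d} (hF : ∀ j, j ≠ 0 → (F j : MvPolynomial (Fin 3) k)
        = ∏ l ∈ Finset.univ.filter (fun l => β l = j), line i (x l)) :
    ∃ w : Fin n → k, (∀ l, w l ≠ 0) ∧ ∀ (H : FormTuple k d) (l : Fin n) (t : k),
      eval (pt i (x l) t) (tangentMap F H) = eval (pt i (x l) t) (F 0 : MvPolynomial (Fin 3) k)
        * (eval (pt i (x l) t) (H (β l) : MvPolynomial (Fin 3) k) * w l) := by
  classical
  refine ⟨fun l => ∏ j ∈ (Finset.univ.erase (β l)).erase 0,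
    ∏ l' ∈ Finset.univ.filter (fun l' => β l' = j), (x l - x l'), fun l => ?_, fun H l t => ?_⟩
  · refine Finset.prod_ne_zero_iff.mpr fun j hj => Finset.prod_ne_zero_iff.mpr fun l' hl' => ?_
    rw [sub_ne_zero]
    intro h
    have hl := (Finset.mem_filter.mp hl').2
    rw [← hx h] at hl
    exact Finset.ne_of_mem_erase (Finset.mem_of_mem_erase hj) hl.symm
  · have hev : ∀ j, j ≠ 0 → eval (pt i (x l) t) (F j : MvPolynomial (Fin 3) k)
        = ∏ l' ∈ Finset.univ.filter (fun l' => β l' = j), (x l - x l') := by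
      intro j hj
      rw [hF j hj, map_prod]
      exact Finset.prod_congr rfl fun l' _ => eval_line_pt hi _ _ _
    have hzero : eval (pt i (x l) t) (F (β l) : MvPolynomial (Fin 3) k) = 0 := by
      rw [hev _ (hβ l)]
      exact Finset.prod_eq_zero (i := l) (by simp) (sub_self _)
    rw [tangentMap_apply, map_sum, Finset.sum_eq_single_of_mem (β l) (Finset.mem_univ _)]
    · rw [map_mul, cofactor, map_prod,
        ← Finset.mul_prod_erase _ _ (Finset.mem_erase.mpr ⟨(hβ l).symm, Finset.mem_univ _⟩),
        Finset.prod_congr rfl fun j hj => hev j (Finset.ne_of_mem_erase hj)]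
      ring
    · intro j _ hj
      rw [map_mul, cofactor, map_prod, Finset.prod_eq_zero (i := β l), mul_zero]
      · exact Finset.mem_erase.mpr ⟨hj.symm, Finset.mem_univ _⟩
      · exact hzero

lemma exists_smul_of_line_dvd [Infinite k] {i : Fin 3} (hi : i ≠ 2) {n : ℕ} {β : Fin n → Fin r}
    (hβ : ∀ j, (Finset.univ.filter fun l => β l = j).card = Function.update d 0 0 j)
    {x : Fin n → k} (hx : Function.Injective x)
    {F : FormTuple k d} (hF : ∀ j, j ≠ 0 → (F j : MvPolynomial (Fin 3) k)
        = ∏ l ∈ Finset.univ.filter (fun l => β l = j), line i (x l))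
    (H : FormTuple k d) (hH : ∀ l, line i (x l) ∣ (H (β l) : MvPolynomial (Fin 3) k))
    (j : Fin r) (hj : j ≠ 0) : ∃ c : k, H j = c • F j := by
  obtain ⟨T, hT, hHT⟩ := prod_line_dvd hi (Finset.univ.filter fun l => β l = j) x hx.injOn (n := 0)
    (P := (H j : MvPolynomial (Fin 3) k))
    (by rw [hβ, Function.update_of_ne hj]; exact (H j).2)
    (fun l hl => by rw [← (Finset.mem_filter.mp hl).2]; exact hH l)
  obtain ⟨c, rfl⟩ : ∃ c, T = C c := ⟨_, totalDegree_eq_zero_iff_eq_C.mp (by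
    have := hT.totalDegree_le; omega)⟩
  refine ⟨c, Subtype.ext ?_⟩
  rw [hHT, ← hF j hj, Submodule.coe_smul, smul_eq_C_mul, mul_comm]

/-- If two products of lines in different pencils satisfy `P ∏ ℓ_i = Q ∏ m_j`,
then each line `m_j` divides `P`. -/
lemma line_dvd_of_mul_prod_eq [Infinite k] {i₁ i₂ : Fin 3} (h₁ : i₁ ≠ 2) (h₂ : i₂ ≠ 2)
    (h₁₂ : i₁ ≠ i₂) {n : ℕ} {x y : Fin n → k} {P Q : MvPolynomial (Fin 3) k} {e : ℕ}
    (hP : P.IsHomogeneous e) (h : P * ∏ l, line i₁ (x l) = Q * ∏ l, line i₂ (y l)) (m : Fin n) :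
    line i₂ (y m) ∣ P := by
  -- Points of the line `m` off the other pencil's lines: there the product multiplying `P` is
  -- nonzero.
  obtain ⟨S, hS, hcard⟩ := (Set.Finite.infinite_compl (Set.finite_range x)).exists_subset_card_eq
    (e + 1)
  refine line_dvd_of_eval_eq_zero h₂ hP (S := S) (by omega) fun t ht => ?_
  have h0 := congrArg (eval (pt i₂ (y m) t)) h
  simp only [map_mul, map_prod, eval_line_pt h₂, eval_line_pt_other h₂ h₁ h₁₂.symm] at h0
  have hz : ∏ l, (y m - y l) = 0 := Finset.prod_eq_zero (Finset.mem_univ m) (sub_self _)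
  rw [hz, mul_zero] at h0
  refine (mul_eq_zero.mp h0).resolve_right (Finset.prod_ne_zero_iff.mpr fun l _ => ?_)
  rw [sub_ne_zero]
  rintro rfl
  exact hS ht ⟨l, rfl⟩

/-- A pair of tuples for which the kernel of `differenceMap` is as small as possible. -/
lemma exists_finrank_ker_differenceMap_le [Infinite k] (hpos : ∀ i, 1 ≤ d i) (hr : 2 < r)
    (hanti : Antitone d) (hps : 3 * s d < 2 * p d) (hd : s d ≤ d 0 + 1) :
    ∃ F G : FormTuple k d, (∀ i, F i ≠ 0) ∧ (∀ i, G i ≠ 0) ∧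
      Module.finrank k (LinearMap.ker (differenceMap F G))
        ≤ (r - 1) + (r - 1) + (d 0 + 2 - s d).choose 2 := by
  classical
  have h0 : (0 : Fin 3) ≠ 2 := by decide
  have h1 : (1 : Fin 3) ≠ 2 := by decide
  have h01 : (0 : Fin 3) ≠ 1 := by decide
  obtain ⟨n, β, U, hU, hcard⟩ := exists_isBalanced hr d hanti hpos hps
  have hβ : ∀ l, β l ≠ 0 := by
    intro l hl
    have := hcard 0
    rw [Function.update_self, Finset.card_eq_zero, Finset.filter_eq_empty_iff] at this
    exact this (Finset.mem_univ l) hl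
  have hn : n = s d := by
    have h := Finset.card_eq_sum_card_fiberwise (f := β) (s := Finset.univ) (t := Finset.univ)
      (fun _ _ => Finset.mem_coe.mpr (Finset.mem_univ _))
    rw [Finset.card_univ, Fintype.card_fin, Finset.sum_congr rfl fun j _ => hcard j,
      Finset.sum_update_of_mem (Finset.mem_univ _), zero_add, Finset.sdiff_singleton_eq_erase,
      sum_erase_zero] at h
    exact h
  have hnpos : 0 < n := by
    rw [hn, ← sum_erase_zero]
    refine lt_of_lt_of_le Nat.one_pos ((hpos ⟨1, by omega⟩).trans
      (Finset.single_le_sum (f := d) (fun _ _ => Nat.zero_le _) ?_))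
    simp [Fin.ext_iff]
  let x : Fin n → k := fun l => Infinite.natEmbedding k l
  have hx : Function.Injective x := fun a b h =>
    Fin.ext ((Infinite.natEmbedding k).injective h)
  -- `P`, the future `F 0`, must vanish at cells below the diagonal, so the lemma is applied to the
  -- transposed grid. Its bound on the degree is `s d ≤ d 0 + 1`.
  obtain ⟨P, hP, hPe⟩ := exists_vanishing_exactly h1 h0 h01.symm hx hx (d 0) (by omega)
    (fun j i => j < i ∧ U i j = false) (fun _ _ h => h.1)
  obtain ⟨Q, hQ, hQe⟩ := exists_vanishing_exactly h0 h1 h01 hx hx (d 0) (by omega)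
    (fun i j => i < j ∧ U i j = true) (fun _ _ h => h.1)
  obtain ⟨F, hF0, hF⟩ := exists_formTuple 0 β x hcard hP
  obtain ⟨G, hG0, hG⟩ := exists_formTuple 1 β x hcard hQ
  have hFne : ∀ i, F i ≠ 0 := by
    intro i
    by_cases hi : i = 0
    · subst hi
      intro h
      have := hPe ⟨0, hnpos⟩ ⟨0, hnpos⟩
      rw [← hF0, h] at this
      simp at this
    · intro h
      have := hF i hi
      rw [h] at this
      exact prod_line_ne_zero h0 _ x this.symm
  have hGne : ∀ i, G i ≠ 0 := by
    intro i
    by_cases hi : i = 0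
    · subst hi
      intro h
      have := hQe ⟨0, hnpos⟩ ⟨0, hnpos⟩
      rw [← hG0, h] at this
      simp at this
    · intro h
      have := hG i hi
      rw [h] at this
      exact prod_line_ne_zero h1 _ x this.symm
  have hcF := cofactor_zero_eq 0 hβ x hF
  have hcG := cofactor_zero_eq 1 hβ x hG
  obtain ⟨u, hu, hue⟩ := exists_eval_tangentMap h0 hβ hx hF
  obtain ⟨v, hv, hve⟩ := exists_eval_tangentMap h1 hβ hx hG
  have hdeg : ∀ (H : FormTuple k d) (l : Fin n), (H (β l) : MvPolynomial (Fin 3) k).IsHomogeneous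
      (Finset.univ.filter fun l' => β l' = β l).card := by
    intro H l
    rw [hcard, Function.update_of_ne (hβ l)]
    exact (H (β l)).2
  have key : ∀ H K : FormTuple k d, tangentMap F H = tangentMap G K →
      ∃ T ∈ trivialRelations F, ∃ T' ∈ trivialRelations G,
        ∃ A B : homogeneousSubmodule (Fin 3) k (d 0), H = T + Pi.single 0 A ∧
          K = T' + Pi.single 0 B ∧
          (A : MvPolynomial (Fin 3) k) * ∏ l, line 0 (x l) = B * ∏ l, line 1 (x l) := by
    intro H K hHK
    have hlines := lines_dvd_of_isBalanced hU hx hx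
      (f := fun i j => eval (pt 0 (x i) (x j)) P) (g := fun i j => eval (pt 0 (x i) (x j)) Q)
      (u := fun i _ => u i) (v := fun _ j => v j)
      (H := fun i => (H i : MvPolynomial (Fin 3) k)) (K := fun i => (K i : MvPolynomial (Fin 3) k))
      (fun i j h h' => by rw [← pt_swap]; exact (hPe j i).mpr ⟨h, h'⟩)
      (fun i j h h' => by
        rw [← pt_swap] at h'
        have := ((hPe j i).mp h').2
        rw [h] at this; exact absurd this (by simp))
      (fun i j h h' => (hQe i j).mpr ⟨h, h'⟩)
      (fun i j h h' => by
        have := ((hQe i j).mp h').2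
        rw [h] at this; exact absurd this (by simp))
      (fun i _ => hu i) (fun _ j => hv j) (hdeg H) (hdeg K)
      (fun i j => by
        have e1 := hue H i (x j)
        have e2 := hve K j (x i)
        rw [pt_swap, ← hHK, e1, hF0, hG0] at e2
        exact e2)
    obtain ⟨T, hT, A, hA⟩ := exists_trivialRelation_add_single F H
      (exists_smul_of_line_dvd h0 hcard hx hF H fun l => (hlines l).1)
    obtain ⟨T', hT', B, hB⟩ := exists_trivialRelation_add_single G K
      (exists_smul_of_line_dvd h1 hcard hx hG K fun l => (hlines l).2)
    refine ⟨T, hT, T', hT', A, B, hA, hB, ?_⟩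
    rw [hA, hB, map_add, map_add, LinearMap.mem_ker.mp (trivialRelations_le_ker F hT),
      LinearMap.mem_ker.mp (trivialRelations_le_ker G hT'), zero_add, zero_add,
      tangentMap_single, tangentMap_single, hcF, hcG] at hHK
    exact hHK
  have : Module.Free k (trivialRelations F) :=
    Module.Free.of_divisionRing (K := k) (V := trivialRelations F)
  have : Module.Free k (trivialRelations G) :=
    Module.Free.of_divisionRing (K := k) (V := trivialRelations G)
  have hdim : Module.finrank k (trivialRelations F × trivialRelations G) ≤ (r - 1) + (r - 1) := by
    rw [Module.finrank_prod]
    exact add_le_add (finrank_trivialRelations_le F) (finrank_trivialRelations_le G)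
  let E : (trivialRelations F × trivialRelations G) →ₗ[k] FormTuple k d × FormTuple k d :=
    (trivialRelations F).subtype.prodMap (trivialRelations G).subtype
  refine ⟨F, G, hFne, hGne, ?_⟩
  by_cases hs : s d ≤ d 0
  · let μ : homogeneousSubmodule (Fin 3) k (d 0 - s d) →ₗ[k] FormTuple k d × FormTuple k d :=
      (LinearMap.single k (fun i => homogeneousSubmodule (Fin 3) k (d i)) 0 ∘ₗ
        mulForm (cofactor_zero_isHomogeneous G) (Nat.sub_add_cancel hs)).prod
      (LinearMap.single k (fun i => homogeneousSubmodule (Fin 3) k (d i)) 0 ∘ₗ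
        mulForm (cofactor_zero_isHomogeneous F) (Nat.sub_add_cancel hs))
    have hle : LinearMap.ker (differenceMap F G) ≤ LinearMap.range (E.coprod μ) := by
      rintro ⟨H, K⟩ hHK
      rw [LinearMap.mem_ker, differenceMap_apply, sub_eq_zero] at hHK
      obtain ⟨T, hT, T', hT', A, B, hA, hB, hAB⟩ := key H K hHK
      obtain ⟨M, hM, hAM⟩ := prod_line_dvd h1 Finset.univ x hx.injOn (n := d 0 - s d)
        (P := (A : MvPolynomial (Fin 3) k))
        (by
          rw [Finset.card_univ, Fintype.card_fin, hn, Nat.add_sub_cancel' hs]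
          exact A.2)
        (fun l _ => line_dvd_of_mul_prod_eq h0 h1 h01 A.2 hAB l)
      have hBM : (B : MvPolynomial (Fin 3) k) = M * ∏ l, line 0 (x l) := by
        apply mul_right_cancel₀ (prod_line_ne_zero h1 Finset.univ x)
        rw [← hAB, hAM]; ring
      refine ⟨((⟨T, hT⟩, ⟨T', hT'⟩), ⟨M, hM⟩), ?_⟩
      have eA : mulForm (cofactor_zero_isHomogeneous G) (Nat.sub_add_cancel hs) ⟨M, hM⟩ = A :=
        Subtype.ext (by rw [mulForm_apply, hcG, hAM, mul_comm])
      have eB : mulForm (cofactor_zero_isHomogeneous F) (Nat.sub_add_cancel hs) ⟨M, hM⟩ = B :=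
        Subtype.ext (by rw [mulForm_apply, hcF, hBM])
      rw [LinearMap.coprod_apply]
      change (T, T') + (Pi.single 0 _, Pi.single 0 _) = (H, K)
      rw [eA, eB, hA, hB, Prod.mk_add_mk]
    refine (Submodule.finrank_mono hle).trans ((LinearMap.finrank_range_le _).trans ?_)
    rw [Module.finrank_prod, finrank_homogeneousSubmodule, Nat.sub_add_comm hs]
    exact Nat.add_le_add_right hdim _
  · have hle : LinearMap.ker (differenceMap F G) ≤ LinearMap.range E := by
      rintro ⟨H, K⟩ hHK
      rw [LinearMap.mem_ker, differenceMap_apply, sub_eq_zero] at hHK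
      obtain ⟨T, hT, T', hT', A, B, hA, hB, hAB⟩ := key H K hHK
      -- Here `d 0 < s d`, so `A` is divisible by more lines than its degree allows.
      have hA0 : A = 0 := Subtype.ext (eq_zero_of_line_dvd h1 Finset.univ x hx.injOn A.2
        (by rw [Finset.card_univ, Fintype.card_fin, hn]; omega)
        (fun l _ => line_dvd_of_mul_prod_eq h0 h1 h01 A.2 hAB l))
      have hB0 : B = 0 := Subtype.ext (eq_zero_of_line_dvd h0 Finset.univ x hx.injOn B.2
        (by rw [Finset.card_univ, Fintype.card_fin, hn]; omega)
        (fun l _ => line_dvd_of_mul_prod_eq h1 h0 h01.symm B.2 hAB.symm l))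
      refine ⟨(⟨T, hT⟩, ⟨T', hT'⟩), ?_⟩
      have hz : (Pi.single 0 0 : FormTuple k d) = 0 := Pi.single_zero 0
      rw [hA, hB, hA0, hB0, hz, add_zero, add_zero]
      rfl
    refine (Submodule.finrank_mono hle).trans ((LinearMap.finrank_range_le _).trans ?_)
    exact hdim.trans (Nat.le_add_right _ _)

end Example

/-! ### The general pair and the defect -/

section General

variable {k : Type*} [Field k] {r : ℕ} {d : Fin r → ℕ}

lemma ForGeneralPair.mono {P Q : FormTuple k d → FormTuple k d → Prop} (h : ForGeneralPair P)
    (hPQ : ∀ F G, P F G → Q F G) : ForGeneralPair Q := by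
  obtain ⟨Φ, hne, hΦ⟩ := h
  exact ⟨Φ, hne, fun F G hFG => hPQ F G (hΦ F G hFG)⟩

lemma exists_isCoordPoly_ne_zero (F₀ G₀ : FormTuple k d) (hF₀ : ∀ i, F₀ i ≠ 0)
    (hG₀ : ∀ i, G₀ i ≠ 0) : ∃ f : FormTuple k d → FormTuple k d → k, IsCoordPoly f ∧
      f F₀ G₀ ≠ 0 ∧ ∀ F G, f F G ≠ 0 → (∀ i, F i ≠ 0) ∧ ∀ i, G i ≠ 0 := by
  have hex : ∀ (H : FormTuple k d), (∀ i, H i ≠ 0) →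
      ∀ i, ∃ m, coeff m (H i : MvPolynomial (Fin 3) k) ≠ 0 := fun H hH i =>
    exists_coeff_ne_zero fun h => hH i (Subtype.ext h)
  choose m hm using hex F₀ hF₀
  choose m' hm' using hex G₀ hG₀
  refine ⟨fun F G => (∏ i, coeff (m i) (F i : MvPolynomial (Fin 3) k))
    * ∏ i, coeff (m' i) (G i : MvPolynomial (Fin 3) k), ?_, ?_, fun F G h => ?_⟩
  · exact (IsCoordPoly.prod _ fun i => IsCoeffPoly.left i _).mul
      (IsCoordPoly.prod _ fun i => IsCoeffPoly.right i _)
  · exact mul_ne_zero (Finset.prod_ne_zero_iff.mpr fun i _ => hm i)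
      (Finset.prod_ne_zero_iff.mpr fun i _ => hm' i)
  · have hl := Finset.prod_ne_zero_iff.mp (left_ne_zero_of_mul h)
    have hr := Finset.prod_ne_zero_iff.mp (right_ne_zero_of_mul h)
    exact ⟨fun i hi => hl i (Finset.mem_univ i) (by rw [hi]; simp),
      fun i hi => hr i (Finset.mem_univ i) (by rw [hi]; simp)⟩

instance finite_degreePart (I : Ideal (MvPolynomial (Fin 3) k)) (n : ℕ) :
    Module.Finite k (degreePart I n) :=
  Submodule.finiteDimensional_inf_right _ _

variable [NeZero r]

lemma choose_le_dimIZ (F G : FormTuple k d) (hF : ∀ i, F i ≠ 0) (hG : ∀ i, G i ≠ 0)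
    (hs : s d ≤ d 0) : (d 0 + 2 - s d).choose 2 ≤ dimIZ F G := by
  have hne : cofactor F 0 * cofactor G 0 ≠ 0 := by
    refine mul_ne_zero ?_ ?_
    · exact Finset.prod_ne_zero_iff.mpr fun j _ h => hF j (Subtype.ext h)
    · exact Finset.prod_ne_zero_iff.mpr fun j _ h => hG j (Subtype.ext h)
  let L : homogeneousSubmodule (Fin 3) k (d 0 - s d) →ₗ[k]
      degreePart (idealZ F G) (totalDeg d) :=
    (LinearMap.mulRight k (cofactor F 0 * cofactor G 0) ∘ₗ Submodule.subtype _).codRestrict _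
      fun P => by
        refine ⟨⟨?_, ?_⟩, ?_⟩
        · change (P : MvPolynomial (Fin 3) k) * (cofactor F 0 * cofactor G 0) ∈ idealY F
          exact Ideal.mul_mem_left _ _ (Ideal.mul_mem_right _ _ (Ideal.subset_span ⟨0, rfl⟩))
        · change (P : MvPolynomial (Fin 3) k) * (cofactor F 0 * cofactor G 0) ∈ idealY G
          exact Ideal.mul_mem_left _ _ (Ideal.mul_mem_left _ _ (Ideal.subset_span ⟨0, rfl⟩))
        · have := IsHomogeneous.mul P.2
            ((cofactor_zero_isHomogeneous F).mul (cofactor_zero_isHomogeneous G))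
          rw [← add_assoc, Nat.sub_add_cancel hs, ← totalDeg_eq] at this
          exact this
  have hL : Function.Injective L := by
    intro P Q h
    exact Subtype.ext (mul_right_cancel₀ hne (congrArg Subtype.val h))
  have := LinearMap.finrank_le_finrank_of_injective hL
  rw [finrank_homogeneousSubmodule] at this
  rwa [Nat.sub_add_comm hs]

lemma dimIZ_add_le_finrank_ker (F G : FormTuple k d) (hF : ∀ i, F i ≠ 0) (hG : ∀ i, G i ≠ 0) :
    dimIZ F G + ((r - 1) + (r - 1)) ≤ Module.finrank k (LinearMap.ker (differenceMap F G)) := by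
  have h := finrank_range_inf_range_le (tangentMap F) (tangentMap G)
  rw [← degreePart_idealZ] at h
  exact (Nat.add_le_add_left (add_le_add (le_finrank_ker_tangentMap F hF)
    (le_finrank_ker_tangentMap G hG)) _).trans h

/-- For a general pair, `dim (I_Z)_d` is the dimension of the space of forms of degree `d₁ - s`. -/
lemma forGeneralPair_dimIZ_eq [Infinite k] (hpos : ∀ i, 1 ≤ d i) (hr : 2 < r) (hanti : Antitone d)
    (hps : 3 * s d < 2 * p d) (hd : s d ≤ d 0 + 1) :
    ForGeneralPair fun F G : FormTuple k d => dimIZ F G = (d 0 + 2 - s d).choose 2 := by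
  obtain ⟨F₀, G₀, hF₀, hG₀, hker⟩ :=
    exists_finrank_ker_differenceMap_le (k := k) hpos hr hanti hps hd
  obtain ⟨f, hf, hf0, hfker⟩ := exists_isCoordPoly_finrank_ker_le F₀ G₀
  obtain ⟨g, hg, hg0, hgne⟩ := exists_isCoordPoly_ne_zero F₀ G₀ hF₀ hG₀
  obtain ⟨Φ, hΦ⟩ := hf.mul hg
  refine ⟨Φ, ⟨F₀, G₀, ?_⟩, fun F G hFG => ?_⟩
  · rw [← hΦ]; exact mul_ne_zero hf0 hg0
  · rw [← hΦ] at hFG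
    obtain ⟨hF, hG⟩ := hgne F G (right_ne_zero_of_mul hFG)
    have h1 := hfker F G (left_ne_zero_of_mul hFG)
    have h2 := dimIZ_add_le_finrank_ker F G hF hG
    refine le_antisymm (by omega) ?_
    by_cases hs : s d ≤ d 0
    · exact choose_le_dimIZ F G hF hG hs
    -- The boundary case `s d = d 0 + 1`, where the binomial coefficient is C(1, 2) = 0.
    · rw [show d 0 + 2 - s d = 1 by omega]; simp

lemma two_mul_choose_two (n : ℕ) : 2 * ((n + 2).choose 2 : ℤ) = (n + 2) * (n + 1) := by
  induction n with
  | zero => simp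
  | succ n ih =>
    rw [Nat.choose_succ_succ' (n + 2) 1, Nat.choose_one_right]
    push_cast
    linarith

/-- With d = d_1 + s and D = d_1 s + p, the difference C(d_1 + s + 2, 2) - C(d_1 - s + 2, 2) equals
s(2d_1 + 3). -/
lemma expDimIZ_eq (hs : s d ≤ d 0) :
    expDimIZ d = max (((d 0 - s d + 2).choose 2 : ℤ) - (2 * (p d : ℤ) - 3 * (s d : ℤ))) 0 := by
  rw [expDimIZ]
  congr 1
  obtain ⟨n, hn⟩ := Nat.exists_eq_add_of_le hs
  have h1 := two_mul_choose_two (totalDeg d)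
  have h2 := two_mul_choose_two (d 0 - s d)
  rw [D_eq]
  rw [totalDeg_eq, hn] at h1 ⊢
  rw [hn] at h2
  rw [Nat.add_sub_cancel_left] at h2 ⊢
  push_cast at h1 h2 ⊢
  linarith

end General

end ReducibleForms

theorem lemma4p10 {k : Type*} [Field k] [IsAlgClosed k] {r : ℕ} [NeZero r] (hr : 2 < r)
    (d : Fin r → ℕ) (hanti : Antitone d) (hpos : ∀ i, 1 ≤ d i)
    (hps : 0 < 2 * (ReducibleForms.p d : ℤ) - 3 * (ReducibleForms.s d : ℤ)) :
    ((d 0 : ℤ) ≥ (ReducibleForms.s d : ℤ) - 1 →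
      ReducibleForms.ForGeneralPair fun F G : ReducibleForms.FormTuple k d =>
        ReducibleForms.dimIZ F G = (d 0 + 2 - ReducibleForms.s d).choose 2) ∧
    (d 0 ≥ ReducibleForms.s d →
      ReducibleForms.ForGeneralPair fun F G : ReducibleForms.FormTuple k d =>
        ReducibleForms.IsDefective F G ∧
        ReducibleForms.defect F G =
          min ((d 0 - ReducibleForms.s d + 2).choose 2 : ℤ)
            (2 * (ReducibleForms.p d : ℤ) - 3 * (ReducibleForms.s d : ℤ))) := by
  have : Infinite k := IsAlgClosed.instInfinite
  have hps' : 3 * ReducibleForms.s d < 2 * ReducibleForms.p d := by omega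
  refine ⟨fun hd => ReducibleForms.forGeneralPair_dimIZ_eq hpos hr hanti hps' (by omega),
    fun hd => (ReducibleForms.forGeneralPair_dimIZ_eq hpos hr hanti hps' (by omega)).mono
      fun F G hFG => ?_⟩
  have hdef : ReducibleForms.defect F G = min ((d 0 - ReducibleForms.s d + 2).choose 2 : ℤ)
      (2 * (ReducibleForms.p d : ℤ) - 3 * (ReducibleForms.s d : ℤ)) := by
    rw [ReducibleForms.defect, hFG, ReducibleForms.expDimIZ_eq hd, Nat.sub_add_comm hd]
    -- For integers with c ≥ 0, c - max(c - e, 0) = min(c, e).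
    omega
  refine ⟨?_, hdef⟩
  rw [ReducibleForms.IsDefective, hdef]
  refine lt_min ?_ hps
  exact_mod_cast Nat.choose_pos (Nat.le_add_left 2 _)
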